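/- Let $\lambda_0,\mu,\delta,\alpha,\beta,L>0$. Let $T_1,T_2,\dots$ be the points of a homogeneous Poisson process of rate $\mu$ on $[0,\infty)$ (the shocks). Conditionally on the shocks, let $S_1,S_2,\dots$ be the points of a Poisson process on $[0,\infty)$ with intensity $$\lambda^*(s)=\lambda_0+\sum_{i:\,T_i\le s}e^{-\delta(s-T_i)},\qquad s\ge 0,$$ i.e. $(S_k)$ is a shot noise Cox process. Let $X^{(1)},X^{(2)},\dots$ be independent homogeneous gamma processes with parameters $\alpha,\beta$ and right-continuous paths, independent of $(T_i)$ and $(S_k)$: $X^{(k)}(0)=0$ a.s., the increments are independent, and $X^{(k)}(t)-X^{(k)}(s)$ has for $s<t$ the gamma distribution with shape $\alpha(t-s)$ and rate $\beta$. Let $\sigma_L^{(k)}=\inf\{t\ge0: X^{(k)}(t)>L\}$, let $W_k=S_k+\sigma_L^{(k)}$ be the time at which the $k$-th degradation process exceeds $L$, and let $W_{[1]}=\inf_k W_k$ be the system failure time. Then: 1. The times $\sigma_L^{(k)}$ have the common distribution function $F_{\sigma_L}$ given, on $[0,\infty)$, by $F_{\sigma_L}(0)=0$ and $F_{\sigma_L}(t)=\Gamma(\alpha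 t)^{-1}\int_{\beta L}^\infty z^{\alpha t-1}e^{-z}\,dz$ for $t>0$. 2. $W_{[1]}$ is an a.s. finite nonnegative random time with increasing failure rate (IFR): its survival function $\bar F(t)=P(W_{[1]}>t)$ is positive and differentiable on $[0,\infty)$ (from the right at $0$), and its failure rate (hazard) $r(t)=-\bar F'(t)/\bar F(t)$ is nondecreasing on $[0,\infty)$. No monotonicity of the failure rate of $\sigma_L^{(k)}$ is assumed. 3. For every $t\ge 0$, $$r(t)=\lambda_0F_{\sigma_L}(t)+\mu\left(1-\exp\left(-\int_0^te^{-\delta w}F_{\sigma_L}(t-w)\,dw\right)\right).$$ 4. $\lim_{t\to\infty}r(t)=\lambda_0+\mu\,(1-e^{-1/\delta})$. -/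

import Mathlib

open MeasureTheory ProbabilityTheory Set Filter Topology
open scoped ENNReal NNReal

namespace ShotNoise

variable {Ω : Type*} [MeasurableSpace Ω]

/-- The (possibly infinite) number of points of the sequence `S` that lie in `B`. -/
noncomputable def pointCount (S : ℕ → Ω → ℝ) (B : Set ℝ) (ω : Ω) : ℕ∞ :=
  {k : ℕ | S k ω ∈ B}.encard

/-- The random points `S 0, S 1, …` of the real line, listed in any order, form a Cox process
directed by the random measure `Λ`, which is a function of the information `𝓖`: conditionally on
`𝓖`, the numbers of points in disjoint bounded Borel sets are independent, and the number of
points in `B` has the Poisson distribution of mean `Λ B`. -/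
structure IsCoxProcess {Ω' : Type*} (𝓖 : MeasurableSpace Ω') [mΩ : MeasurableSpace Ω']
    (P : Measure Ω') (Λ : Ω' → Measure ℝ) (S : ℕ → Ω' → ℝ) : Prop where
  measurable : ∀ k, Measurable[mΩ] (S k)
  locallyFinite : ∀ᵐ ω ∂P, IsLocallyFiniteMeasure (Λ ω)
  condCount : ∀ (n : ℕ) (B : Fin n → Set ℝ), (∀ j, MeasurableSet (B j)) →
    (∀ j, Bornology.IsBounded (B j)) → Pairwise (fun i j => Disjoint (B i) (B j)) →
    ∀ c : Fin n → ℕ,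
      P⟦{ω | ∀ j, pointCount S (B j) ω = (c j : ℕ∞)} | 𝓖⟧ =ᵐ[P]
        fun ω => ∏ j, (poissonMeasure (Λ ω (B j)).toNNReal).real {c j}

/-- `T` lists the points of a Poisson process with the deterministic mean measure `ν`, that is, of
a Cox process whose directing measure is not random (conditioning on the trivial σ-algebra is no
conditioning). -/
def IsPoissonProcess (P : Measure Ω) (ν : Measure ℝ) (T : ℕ → Ω → ℝ) : Prop :=
  IsCoxProcess ⊥ P (fun _ => ν) T

/-- The shot noise intensity at time `s`: `lam + ∑_{i : T i ≤ s} exp (-δ (s - T i))`. -/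
noncomputable def intensity (lam δ : ℝ) (T : ℕ → Ω → ℝ) (ω : Ω) (s : ℝ) : ℝ≥0∞ :=
  ENNReal.ofReal lam +
    ∑' i, if T i ω ≤ s then ENNReal.ofReal (Real.exp (-δ * (s - T i ω))) else 0

/-- The random measure on `[0, ∞)` whose density is the shot noise intensity. -/
noncomputable def intensityMeasure (lam δ : ℝ) (T : ℕ → Ω → ℝ) (ω : Ω) : Measure ℝ :=
  (volume.restrict (Ici 0)).withDensity (intensity lam δ T ω)

/-- A homogeneous gamma process of parameters `α`, `β`, with right-continuous paths. The increment
over `[s, t]` has density `β ^ a / Γ(a) * x ^ (a - 1) * exp (-β x)` for `x > 0`,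
where `a = α (t - s)`. -/
structure IsGammaProcess (P : Measure Ω) (α β : ℝ) (X : ℝ≥0 → Ω → ℝ) : Prop where
  measurable : ∀ t, Measurable (X t)
  start : ∀ᵐ ω ∂P, X 0 ω = 0
  increment : ∀ s t : ℝ≥0, s < t →
    P.map (fun ω => X t ω - X s ω) = gammaMeasure (α * ((t : ℝ) - s)) β
  indep : HasIndepIncrements X P
  rightCont : ∀ᵐ ω ∂P, ∀ t, ContinuousWithinAt (fun s => X s ω) (Ici t) t

/-- The degradation model: the shock times `T` form a homogeneous Poisson process of rate `μ` on
`[0, ∞)`; the starting times `S` of the degradation processes form a shot noise Cox process, with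
base level `lam` and decay rate `δ`, driven by these shocks; the degradation processes `X 0, X 1, …`
are independent homogeneous gamma processes of parameters `α`, `β` (hence identically
distributed), independent of the shocks and of the starting times. -/
structure IsModel (P : Measure Ω) (lam μ δ α β : ℝ) (T S : ℕ → Ω → ℝ) (X : ℕ → ℝ≥0 → Ω → ℝ) :
    Prop where
  shocks : IsPoissonProcess P (ENNReal.ofReal μ • volume.restrict (Ici 0)) T
  starts : IsCoxProcess (MeasurableSpace.comap (fun ω i => T i ω) inferInstance) P
    (intensityMeasure lam δ T) S
  growth : ∀ k, IsGammaProcess P α β (X k)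
  growth_indep : iIndepFun (fun k ω t => X k t ω) P
  indep : IndepFun (fun ω => ((fun i => T i ω), (fun k => S k ω))) (fun ω k t => X k t ω) P

/-- The first time at which the path `X` exceeds the level `L` (`⊤` if there is none). -/
noncomputable def hittingTime (L : ℝ) (X : ℝ≥0 → Ω → ℝ) (ω : Ω) : EReal :=
  ⨅ (t : ℝ≥0) (_ : L < X t ω), ((t : ℝ) : EReal)

/-- The distribution function of the hitting time of `L`. -/
noncomputable def hittingCDF (P : Measure Ω) (L : ℝ) (X : ℝ≥0 → Ω → ℝ) (t : ℝ) : ℝ :=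
  P.real {ω | hittingTime L X ω ≤ (t : EReal)}

/-- The first time at which the level of one of the degradation processes exceeds `L`: the process
`k` does so at time `S k` plus its own hitting time. -/
noncomputable def failureTime (L : ℝ) (S : ℕ → Ω → ℝ) (X : ℕ → ℝ≥0 → Ω → ℝ) (ω : Ω) : EReal :=
  ⨅ k, ((S k ω : ℝ) : EReal) + hittingTime L (X k) ω

/-- The survival function of a random time. -/
noncomputable def survival (P : Measure Ω) (W : Ω → EReal) (t : ℝ) : ℝ :=
  P.real {ω | (t : EReal) < W ω}

/-- The failure rate (hazard) at time `t ≥ 0` of a random time: its density, which is minus the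
derivative of the survival function (the right derivative at `t = 0`), divided by the survival
function. -/
noncomputable def failureRate (P : Measure Ω) (W : Ω → EReal) (t : ℝ) : ℝ :=
  -derivWithin (survival P W) (Ici 0) t / survival P W t

/-- `W` is a finite nonnegative random time which has a failure rate as long as survival has
positive probability, and this failure rate is nondecreasing. -/
structure IsIFR (P : Measure Ω) (W : Ω → EReal) : Prop where
  aemeasurable : AEMeasurable W P
  nonneg_finite : ∀ᵐ ω ∂P, 0 ≤ W ω ∧ W ω < ⊤
  differentiable : ∀ t, 0 ≤ t → 0 < survival P W t →
    DifferentiableWithinAt ℝ (survival P W) (Ici 0) t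
  monotone : MonotoneOn (failureRate P W) {t | 0 ≤ t ∧ 0 < survival P W t}

end ShotNoise

/-!
Conditionally on the starting times `S k`, the system survives beyond `t` with probability
`∏ₖ (1 - F (t - S k))`, because the hitting times are independent with the common distribution
function `F`. The probability generating functional of a Cox process turns the mean of such a
product into the mean of `exp (-∫ F (t - s) dΛ(s))`. For the shot noise measure this exponent is
`λ₀ ∫₀ᵗ F` plus one term for each shock, so that the same formula, applied to the Poisson process
of the shocks, gives the survival probability `exp (-∫₀ᵗ r)`. Here `r` is nondecreasing because `F`
is, whatever the failure rate of the hitting times.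
-/

namespace ShotNoise

section GammaFunction

/-- The regularized upper incomplete gamma function `Γ(a, c) / Γ(a)`: the probability that a gamma
variable of shape `a` and rate `1` exceeds `c`. Its value at `a = 0` is `0`, since `Γ(0) = 0` by
convention. -/
noncomputable def gammaTail (c a : ℝ) : ℝ :=
  (∫ z in Ioi c, z ^ (a - 1) * Real.exp (-z)) / Real.Gamma a

lemma gammaTail_zero (c : ℝ) : gammaTail c 0 = 0 := by
  rw [gammaTail, Real.Gamma_zero, div_zero]

lemma continuous_inv_Gamma : Continuous fun a : ℝ => (Real.Gamma a)⁻¹ := by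
  have h : Continuous fun a : ℝ => ((Complex.Gamma (a : ℂ))⁻¹).re :=
    Complex.continuous_re.comp
      (Complex.differentiable_one_div_Gamma.continuous.comp Complex.continuous_ofReal)
  refine h.congr fun a => ?_
  rw [Complex.Gamma_ofReal, ← Complex.ofReal_inv, Complex.ofReal_re]

lemma integrableOn_rpow_mul_exp_neg {c : ℝ} (hc : 0 < c) (a : ℝ) :
    IntegrableOn (fun z : ℝ => z ^ a * Real.exp (-z)) (Ioi c) := by
  refine integrable_of_isBigO_exp_neg (b := 1 / 2) (by norm_num) ?_ ?_
  · exact (continuousOn_id.rpow_const fun z hz => .inl (hc.trans_le hz).ne').mul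
      (by fun_prop)
  · simpa only [mul_comm] using (Real.Gamma_integrand_isLittleO a).isBigO

lemma rpow_le_rpow_add_rpow {z a b c : ℝ} (hz : 0 < z) (hab : a ≤ b) (hbc : b ≤ c) :
    z ^ b ≤ z ^ a + z ^ c := by
  have ha : 0 ≤ z ^ a := by positivity
  have hc : 0 ≤ z ^ c := by positivity
  rcases le_total 1 z with h | h
  · linarith [Real.rpow_le_rpow_of_exponent_le h hbc]
  · linarith [Real.rpow_le_rpow_of_exponent_ge hz h hab]

lemma continuous_gammaTail {c : ℝ} (hc : 0 < c) : Continuous (gammaTail c) := by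
  refine .mul (continuous_iff_continuousAt.2 fun a₀ => ?_) continuous_inv_Gamma
  have hbound := (integrableOn_rpow_mul_exp_neg hc (a₀ - 1 - 1)).add
    (integrableOn_rpow_mul_exp_neg hc (a₀ + 1 - 1))
  refine continuousAt_of_dominated (.of_forall fun a => by fun_prop) ?_ hbound ?_
  · filter_upwards [Icc_mem_nhds (sub_one_lt a₀) (lt_add_one a₀)] with a ha
    filter_upwards [ae_restrict_mem measurableSet_Ioi] with z hz
    have hz0 : 0 < z := hc.trans hz
    rw [Real.norm_of_nonneg (by positivity), Pi.add_apply, ← add_mul]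
    gcongr
    exact rpow_le_rpow_add_rpow hz0 (sub_le_sub_right ha.1 1) (sub_le_sub_right ha.2 1)
  · filter_upwards [ae_restrict_mem measurableSet_Ioi] with z hz
    have hz0 : z ≠ 0 := (hc.trans hz).ne'
    exact (((Real.continuous_const_rpow hz0).comp (continuous_sub_right 1)).mul
      continuous_const).continuousAt

lemma one_sub_rpow_div_Gamma_le_gammaTail {c a : ℝ} (hc : 0 ≤ c) (ha : 0 < a) :
    1 - c ^ a / Real.Gamma (a + 1) ≤ gammaTail c a := by
  set g : ℝ → ℝ := fun z => z ^ (a - 1) * Real.exp (-z)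
  have hg : IntegrableOn g (Ioi 0) := by
    simpa only [g, mul_comm] using Real.GammaIntegral_convergent ha
  have hsplit : Real.Gamma a = (∫ z in 0..c, g z) + ∫ z in Ioi c, g z := by
    rw [intervalIntegral.integral_of_le hc, ← setIntegral_union (Ioc_disjoint_Ioi le_rfl)
      measurableSet_Ioi (hg.mono_set Ioc_subset_Ioi_self) (hg.mono_set (Ioi_subset_Ioi hc)),
      Ioc_union_Ioi_eq_Ioi hc, Real.Gamma_eq_integral ha]
    simp only [g, mul_comm]
  have hlower : ∫ z in 0..c, g z ≤ c ^ a / a := by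
    calc ∫ z in 0..c, g z
      _ ≤ ∫ z in 0..c, z ^ (a - 1) := by
        refine intervalIntegral.integral_mono_on hc ?_ ?_ fun z hz => ?_
        · exact (intervalIntegrable_iff_integrableOn_Ioc_of_le hc).2
            (hg.mono_set Ioc_subset_Ioi_self)
        · exact intervalIntegral.intervalIntegrable_rpow' (by linarith)
        · exact mul_le_of_le_one_right (Real.rpow_nonneg hz.1 _)
            (Real.exp_le_one_iff.2 (neg_nonpos.2 hz.1))
      _ = c ^ a / a := by
        rw [integral_rpow (.inl (by linarith)), sub_add_cancel, Real.zero_rpow ha.ne', sub_zero]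
  have hΓ := Real.Gamma_pos_of_pos ha
  calc 1 - c ^ a / Real.Gamma (a + 1)
    _ = (Real.Gamma a - c ^ a / a) / Real.Gamma a := by
      rw [Real.Gamma_add_one ha.ne', sub_div, div_self hΓ.ne', div_div]
    _ ≤ gammaTail c a := by rw [gammaTail]; gcongr; linarith

lemma gammaMeasure_real_Ioi {a r x : ℝ} (ha : 0 < a) (hr : 0 < r) (hx : 0 ≤ x) :
    (gammaMeasure a r).real (Ioi x) = gammaTail (r * x) a := by
  have hpdf : EqOn (gammaPDFReal a r)
      (fun y => r / Real.Gamma a * ((r * y) ^ (a - 1) * Real.exp (-(r * y)))) (Ioi x) := by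
    intro y hy
    have hy0 : 0 < y := hx.trans_lt hy
    simp only [gammaPDFReal, if_pos hy0.le, Real.mul_rpow hr.le hy0.le, Real.rpow_sub_one hr.ne']
    field_simp
  calc (gammaMeasure a r).real (Ioi x)
    _ = ∫ y in Ioi x, gammaPDFReal a r y := by
      rw [measureReal_def, gammaMeasure, withDensity_apply _ measurableSet_Ioi]
      exact (integral_eq_lintegral_of_nonneg_ae (ae_of_all _ fun _ => gammaPDFReal_nonneg ha hr _)
        (by fun_prop)).symm
    _ = gammaTail (r * x) a := by
      rw [setIntegral_congr_fun measurableSet_Ioi hpdf, integral_const_mul,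
        integral_comp_mul_left_Ioi (fun z : ℝ => z ^ (a - 1) * Real.exp (-z)) x hr, gammaTail,
        smul_eq_mul]
      field_simp

lemma gammaTail_le_one {c a : ℝ} (hc : 0 ≤ c) (ha : 0 < a) : gammaTail c a ≤ 1 := by
  have := isProbabilityMeasure_gammaMeasure ha one_pos
  rw [← one_mul c, ← gammaMeasure_real_Ioi ha one_pos hc]
  exact measureReal_le_one

lemma tendsto_gammaTail_natCast {c : ℝ} (hc : 0 ≤ c) :
    Tendsto (fun n : ℕ => gammaTail c n) atTop (𝓝 1) := by
  have hlower : Tendsto (fun n : ℕ => 1 - c ^ n / n.factorial) atTop (𝓝 1) := by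
    simpa only [sub_zero] using (FloorSemiring.tendsto_pow_div_factorial_atTop c).const_sub 1
  refine tendsto_of_tendsto_of_tendsto_of_le_of_le' hlower tendsto_const_nhds ?_ ?_
  all_goals filter_upwards [eventually_gt_atTop 0] with n hn
  · simpa only [Real.rpow_natCast, Real.Gamma_nat_eq_factorial] using
      one_sub_rpow_div_Gamma_le_gammaTail hc (Nat.cast_pos.2 hn)
  · exact gammaTail_le_one hc (Nat.cast_pos.2 hn)

end GammaFunction

section HittingTime

open TopologicalSpace (denseSeq denseRange_denseSeq)

variable {Ω : Type*} {α β L : ℝ} {X : ℝ≥0 → Ω → ℝ}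

lemma hittingTime_nonneg (L : ℝ) (X : ℝ≥0 → Ω → ℝ) (ω : Ω) : 0 ≤ hittingTime L X ω :=
  le_iInf₂ fun t _ => EReal.coe_nonneg.2 t.2

lemma hittingTime_lt_iff {ω : Ω} {t : ℝ} :
    hittingTime L X ω < (t : EReal) ↔ ∃ s : ℝ≥0, L < X s ω ∧ (s : ℝ) < t := by
  simp only [hittingTime, iInf_lt_iff, EReal.coe_lt_coe_iff, exists_prop]

/-- The infimum of the times in a fixed countable dense set at which the path `x` exceeds the level
`L`. Unlike `hittingTime`, it is a measurable function of the path; the two agree on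
right-continuous paths. -/
noncomputable def denseHittingTime (L : ℝ) (x : ℝ≥0 → ℝ) : EReal :=
  ⨅ n : ℕ, if L < x (denseSeq ℝ≥0 n) then (((denseSeq ℝ≥0 n : ℝ≥0) : ℝ) : EReal) else ⊤

lemma measurable_denseHittingTime (L : ℝ) : Measurable (denseHittingTime L) :=
  .iInf fun _ => .ite (measurableSet_lt measurable_const (measurable_pi_apply _))
    measurable_const measurable_const

lemma exists_denseSeq_of_lt {x : ℝ≥0 → ℝ} (hx : ∀ t, ContinuousWithinAt x (Ici t) t)
    {s : ℝ≥0} {t : ℝ} (hs : L < x s) (hst : (s : ℝ) < t) :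
    ∃ n, L < x (denseSeq ℝ≥0 n) ∧ ((denseSeq ℝ≥0 n : ℝ≥0) : ℝ) < t := by
  have hxs : ∀ᶠ u in 𝓝[>] s, L < x u :=
    ((hx s).mono_left (nhdsWithin_mono _ Ioi_subset_Ici_self)).eventually (lt_mem_nhds hs)
  have hlt : ∀ᶠ u : ℝ≥0 in 𝓝[>] s, (u : ℝ) < t :=
    NNReal.continuous_coe.continuousWithinAt.tendsto.eventually (gt_mem_nhds hst)
  obtain ⟨b, hb, hsub⟩ := mem_nhdsGT_iff_exists_Ioo_subset.1 (hxs.and hlt)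
  obtain ⟨n, hn⟩ := (denseRange_denseSeq ℝ≥0).exists_mem_open isOpen_Ioo (nonempty_Ioo.2 hb)
  exact ⟨n, hsub hn⟩

lemma denseHittingTime_eq_hittingTime {ω : Ω}
    (hX : ∀ t, ContinuousWithinAt (fun s => X s ω) (Ici t) t) :
    denseHittingTime L (fun t => X t ω) = hittingTime L X ω := by
  apply le_antisymm
  · refine EReal.le_of_forall_lt_iff_le.1 fun z hz => ?_
    obtain ⟨s, hs, hsz⟩ := hittingTime_lt_iff.1 hz
    obtain ⟨n, hn, hnz⟩ := exists_denseSeq_of_lt hX hs hsz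
    refine (iInf_le _ n).trans ?_
    rw [if_pos hn]
    exact EReal.coe_le_coe_iff.2 hnz.le
  · refine le_iInf fun n => ?_
    split_ifs with h
    · exact iInf₂_le (f := fun (t : ℝ≥0) (_ : L < X t ω) => ((t : ℝ) : EReal)) _ h
    · exact le_top

variable [MeasurableSpace Ω] {P : Measure Ω}

lemma hittingCDF_of_neg {t : ℝ} (ht : t < 0) : hittingCDF P L X t = 0 := by
  have : {ω | hittingTime L X ω ≤ (t : EReal)} = ∅ := eq_empty_of_forall_notMem fun ω hω =>
    (EReal.coe_neg'.2 ht).not_ge ((hittingTime_nonneg L X ω).trans hω)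
  rw [hittingCDF, this, measureReal_empty]

lemma monotone_hittingCDF [IsFiniteMeasure P] : Monotone (hittingCDF P L X) :=
  fun _ _ hst => measureReal_mono fun _ hω => le_trans hω (EReal.coe_le_coe_iff.2 hst)

lemma hittingCDF_mem_Icc [IsZeroOrProbabilityMeasure P] (t : ℝ) :
    hittingCDF P L X t ∈ Icc (0 : ℝ) 1 :=
  ⟨measureReal_nonneg, measureReal_le_one⟩

namespace IsGammaProcess

lemma ae_denseHittingTime_eq (h : IsGammaProcess P α β X) :
    (fun ω => denseHittingTime L fun t => X t ω) =ᵐ[P] hittingTime L X :=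
  h.rightCont.mono fun _ => denseHittingTime_eq_hittingTime

lemma aemeasurable_hittingTime (h : IsGammaProcess P α β X) : AEMeasurable (hittingTime L X) P :=
  ⟨_, (measurable_denseHittingTime L).comp (measurable_pi_lambda _ h.measurable),
    h.ae_denseHittingTime_eq.symm⟩

lemma ae_le (h : IsGammaProcess P α β X) {s t : ℝ≥0} (hst : s ≤ t) :
    ∀ᵐ ω ∂P, X s ω ≤ X t ω := by
  rcases hst.eq_or_lt with rfl | hst
  · exact ae_of_all _ fun _ => le_rfl
  have hneg : P.map (fun ω => X t ω - X s ω) (Iio 0) = 0 := by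
    rw [h.increment s t hst, gammaMeasure, withDensity_apply _ measurableSet_Iio]
    exact lintegral_gammaPDF_of_nonpos le_rfl
  have hm : Measurable fun ω => X t ω - X s ω := (h.measurable t).sub (h.measurable s)
  rw [Measure.map_apply hm measurableSet_Iio] at hneg
  filter_upwards [measure_eq_zero_iff_ae_notMem.1 hneg] with ω hω
  exact sub_nonneg.1 (not_lt.1 hω)

lemma real_lt (h : IsGammaProcess P α β X) (hα : 0 < α) (hβ : 0 < β) (hL : 0 ≤ L)
    {t : ℝ≥0} (ht : 0 < t) : P.real {ω | L < X t ω} = gammaTail (β * L) (α * t) := by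
  have hm : Measurable fun ω => X t ω - X 0 ω := (h.measurable t).sub (h.measurable 0)
  have hincr := h.increment 0 t ht
  rw [NNReal.coe_zero, sub_zero] at hincr
  rw [← gammaMeasure_real_Ioi (mul_pos hα (NNReal.coe_pos.2 ht)) hβ hL, ← hincr,
    map_measureReal_apply hm measurableSet_Ioi]
  refine measureReal_congr ?_
  filter_upwards [h.start] with ω hω
  exact propext (by change L < X t ω ↔ L < X t ω - X 0 ω; rw [hω, sub_zero])

lemma ae_lt_of_hittingTime_lt (h : IsGammaProcess P α β X) (t : ℝ≥0) :
    ∀ᵐ ω ∂P, hittingTime L X ω < ((t : ℝ) : EReal) → L < X t ω := by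
  have hmono : ∀ᵐ ω ∂P, ∀ n, denseSeq ℝ≥0 n ≤ t → X (denseSeq ℝ≥0 n) ω ≤ X t ω := by
    simp only [ae_all_iff]
    exact fun n hn => h.ae_le hn
  filter_upwards [hmono, h.rightCont] with ω hω hr hlt
  obtain ⟨s, hs, hst⟩ := hittingTime_lt_iff.1 hlt
  obtain ⟨n, hn, hnt⟩ := exists_denseSeq_of_lt hr hs hst
  exact hn.trans_le (hω n (NNReal.coe_lt_coe.1 hnt).le)

lemma hittingCDF_of_nonneg [IsFiniteMeasure P] (h : IsGammaProcess P α β X) (hα : 0 < α)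
    (hβ : 0 < β) (hL : 0 < L) {t : ℝ} (ht : 0 ≤ t) :
    hittingCDF P L X t = gammaTail (β * L) (α * t) := by
  apply le_antisymm
  · have hlim : Tendsto (fun u => gammaTail (β * L) (α * u)) (𝓝[>] t)
        (𝓝 (gammaTail (β * L) (α * t))) :=
      ((continuous_gammaTail (mul_pos hβ hL)).comp (continuous_const_mul α)).continuousWithinAt
    refine ge_of_tendsto hlim ?_
    filter_upwards [self_mem_nhdsWithin] with u (hu : t < u)
    lift u to ℝ≥0 using ht.trans hu.le
    rw [← h.real_lt hα hβ hL.le (NNReal.coe_pos.1 (ht.trans_lt hu))]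
    refine ENNReal.toReal_mono (measure_ne_top _ _) (measure_mono_ae ?_)
    filter_upwards [h.ae_lt_of_hittingTime_lt u] with ω hω hle
    exact hω (lt_of_le_of_lt hle (EReal.coe_lt_coe_iff.2 hu))
  · rcases ht.eq_or_lt with rfl | ht0
    · rw [mul_zero, gammaTail_zero]
      exact measureReal_nonneg
    · lift t to ℝ≥0 using ht
      rw [← h.real_lt hα hβ hL.le (NNReal.coe_pos.1 ht0)]
      exact measureReal_mono fun ω (hω : L < X t ω) =>
        iInf₂_le (f := fun (t : ℝ≥0) (_ : L < X t ω) => ((t : ℝ) : EReal)) t hω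

lemma hittingCDF_eq [IsFiniteMeasure P] (h : IsGammaProcess P α β X) (hα : 0 < α) (hβ : 0 < β)
    (hL : 0 < L) (t : ℝ) : hittingCDF P L X t = gammaTail (β * L) (α * max t 0) := by
  rcases le_or_gt 0 t with ht | ht
  · rw [h.hittingCDF_of_nonneg hα hβ hL ht, max_eq_left ht]
  · rw [hittingCDF_of_neg ht, max_eq_right ht.le, mul_zero, gammaTail_zero]

lemma continuous_hittingCDF [IsFiniteMeasure P] (h : IsGammaProcess P α β X) (hα : 0 < α)
    (hβ : 0 < β) (hL : 0 < L) : Continuous (hittingCDF P L X) := by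
  rw [funext (h.hittingCDF_eq hα hβ hL)]
  exact (continuous_gammaTail (mul_pos hβ hL)).comp (by fun_prop)

lemma tendsto_hittingCDF [IsFiniteMeasure P] (h : IsGammaProcess P α β X) (hα : 0 < α)
    (hβ : 0 < β) (hL : 0 < L) : Tendsto (hittingCDF P L X) atTop (𝓝 1) := by
  have hn : Tendsto (fun n : ℕ => (n : ℝ) / α) atTop atTop :=
    tendsto_natCast_atTop_atTop.atTop_div_const hα
  refine (tendsto_iff_tendsto_subseq_of_monotone monotone_hittingCDF hn).2 ?_
  refine (tendsto_gammaTail_natCast (mul_pos hβ hL).le).congr fun n => ?_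
  rw [Function.comp_apply, h.hittingCDF_of_nonneg hα hβ hL (by positivity),
    mul_div_cancel₀ _ hα.ne']

end IsGammaProcess

end HittingTime

lemma integral_pow_poissonMeasure (r : ℝ≥0) (p : ℝ) :
    ∫ n, p ^ n ∂poissonMeasure r = Real.exp (-((1 - p) * r)) := by
  calc ∫ n, p ^ n ∂poissonMeasure r
    _ = ∑' n : ℕ, Real.exp (-r) * ((p * r) ^ n / n.factorial) := by
      rw [integral_poissonMeasure]
      exact tsum_congr fun n => by rw [smul_eq_mul, mul_pow]; ring
    _ = Real.exp (-r) * Real.exp (p * r) := by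
      rw [tsum_mul_left, Real.exp_eq_exp_ℝ, NormedSpace.exp_eq_tsum_div]
    _ = Real.exp (-((1 - p) * r)) := by rw [← Real.exp_add]; ring_nf

section PointCount

variable {Ω : Type*} {S : ℕ → Ω → ℝ}

lemma pointCount_eq_coe_iff {B : Set ℝ} {ω : Ω} (hfin : {k | S k ω ∈ B}.Finite) {c : ℕ} :
    pointCount S B ω = (c : ℕ∞) ↔ {k | S k ω ∈ B}.ncard = c := by
  rw [pointCount, ← hfin.cast_ncard_eq, Nat.cast_inj]

variable [MeasurableSpace Ω]

lemma measurable_pointCount (hS : ∀ k, Measurable (S k)) {B : Set ℝ} (hB : MeasurableSet B) :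
    Measurable (pointCount S B) := by
  have hsum : Measurable fun ω => ((pointCount S B ω : ℕ∞) : ℝ≥0∞) := by
    have : ∀ ω, ((pointCount S B ω : ℕ∞) : ℝ≥0∞) = ∑' k, (S k ⁻¹' B).indicator 1 ω := fun ω => by
      rw [pointCount, ← Measure.count_apply (MeasurableSet.of_discrete), ← lintegral_indicator_one
        MeasurableSet.of_discrete, lintegral_count]
      rfl
    simp only [this]
    exact .tsum fun k => measurable_one.indicator (hS k hB)
  refine measurable_to_countable' fun c => ?_
  convert hsum (measurableSet_singleton (c : ℝ≥0∞)) using 1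
  ext ω
  simp only [mem_preimage, mem_singleton_iff, ENat.toENNReal_inj]

lemma measurable_ncard (hS : ∀ k, Measurable (S k)) {B : Set ℝ} (hB : MeasurableSet B) :
    Measurable fun ω => {k | S k ω ∈ B}.ncard :=
  (Measurable.of_discrete (f := ENat.toNat)).comp (measurable_pointCount hS hB)

end PointCount

namespace IsCoxProcess

variable {Ω : Type*} {𝓖 : MeasurableSpace Ω} [mΩ : MeasurableSpace Ω] {P : Measure Ω}
  {Λ : Ω → Measure ℝ} {S : ℕ → Ω → ℝ} {ι : Type*} [Fintype ι] {B : ι → Set ℝ}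

lemma condExp_pointCount_eq (h : IsCoxProcess 𝓖 P Λ S) (hB : ∀ j, MeasurableSet (B j))
    (hb : ∀ j, Bornology.IsBounded (B j)) (hd : Pairwise fun i j => Disjoint (B i) (B j))
    (c : ι → ℕ) :
    P⟦{ω | ∀ j, pointCount S (B j) ω = (c j : ℕ∞)} | 𝓖⟧ =ᵐ[P]
      fun ω => (Measure.pi fun j => poissonMeasure (Λ ω (B j)).toNNReal).real {c} := by
  set e := (Fintype.equivFin ι).symm
  have hcond := h.condCount _ (B ∘ e) (fun j => hB (e j)) (fun j => hb (e j))
    (fun i j hij => hd (e.injective.ne hij)) (c ∘ e)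
  have hset : {ω | ∀ j, pointCount S ((B ∘ e) j) ω = ((c ∘ e) j : ℕ∞)} =
      {ω | ∀ j, pointCount S (B j) ω = (c j : ℕ∞)} :=
    ext fun ω => e.forall_congr_right (q := fun j => pointCount S (B j) ω = (c j : ℕ∞))
  rw [hset] at hcond
  refine hcond.trans (ae_of_all _ fun ω => ?_)
  simp only [measureReal_def (Measure.pi _), Measure.pi_singleton, ENNReal.toReal_prod]
  exact e.prod_comp fun j => (poissonMeasure (Λ ω (B j)).toNNReal).real {c j}

lemma aemeasurable_pi_poissonMeasure (h : IsCoxProcess 𝓖 P Λ S)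
    (hB : ∀ j, MeasurableSet (B j)) (hb : ∀ j, Bornology.IsBounded (B j))
    (hd : Pairwise fun i j => Disjoint (B i) (B j)) (c : ι → ℕ) :
    AEMeasurable (fun ω => (Measure.pi fun j => poissonMeasure (Λ ω (B j)).toNNReal) {c}) P := by
  have := (integrable_condExp.congr (h.condExp_pointCount_eq hB hb hd c)).aemeasurable
  exact this.ennreal_ofReal.congr (ae_of_all _ fun ω => ofReal_measureReal)

lemma aemeasurable_measureReal (h : IsCoxProcess 𝓖 P Λ S) {B : Set ℝ} (hB : MeasurableSet B)
    (hb : Bornology.IsBounded B) : AEMeasurable (fun ω => (Λ ω).real B) P := by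
  have hvoid := h.aemeasurable_pi_poissonMeasure (ι := Unit) (fun _ => hB) (fun _ => hb)
    (fun _ _ hij => (hij rfl).elim) 0
  refine (Real.measurable_log.comp_aemeasurable hvoid.ennreal_toReal).neg.congr
    (ae_of_all _ fun ω => ?_)
  simp only [Measure.pi_singleton, Fintype.prod_unique, Pi.zero_apply, ← measureReal_def,
    poissonMeasure_real_singleton, pow_zero, Nat.factorial_zero, Nat.cast_one, div_one, mul_one,
    Real.log_exp, Pi.neg_apply, neg_neg, Function.comp_apply]
  rfl

variable [IsProbabilityMeasure P]

lemma measure_pointCount_eq (h : IsCoxProcess 𝓖 P Λ S) (h𝓖 : 𝓖 ≤ mΩ)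
    (hB : ∀ j, MeasurableSet (B j)) (hb : ∀ j, Bornology.IsBounded (B j))
    (hd : Pairwise fun i j => Disjoint (B i) (B j)) (c : ι → ℕ) :
    P {ω | ∀ j, pointCount S (B j) ω = (c j : ℕ∞)} =
      ∫⁻ ω, (Measure.pi fun j => poissonMeasure (Λ ω (B j)).toNNReal) {c} ∂P := by
  have hA : MeasurableSet {ω | ∀ j, pointCount S (B j) ω = (c j : ℕ∞)} := by
    rw [ofPred_forall]
    exact .iInter fun j => measurable_pointCount h.measurable (hB j) (measurableSet_singleton _)
  have hcond := h.condExp_pointCount_eq hB hb hd c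
  calc P {ω | ∀ j, pointCount S (B j) ω = (c j : ℕ∞)}
    _ = ENNReal.ofReal (∫ ω, (P⟦{ω | ∀ j, pointCount S (B j) ω = (c j : ℕ∞)} | 𝓖⟧) ω ∂P) := by
      rw [integral_condExp h𝓖, integral_indicator_const _ hA, smul_eq_mul, mul_one,
        ofReal_measureReal]
    _ = ∫⁻ ω, (Measure.pi fun j => poissonMeasure (Λ ω (B j)).toNNReal) {c} ∂P := by
      rw [integral_congr_ae hcond, ofReal_integral_eq_lintegral_ofReal
        (integrable_condExp.congr hcond) (ae_of_all _ fun _ => measureReal_nonneg)]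
      exact lintegral_congr fun ω => ofReal_measureReal

lemma tsum_mul_measure_pointCount_eq (h : IsCoxProcess 𝓖 P Λ S) (h𝓖 : 𝓖 ≤ mΩ)
    (hB : ∀ j, MeasurableSet (B j)) (hb : ∀ j, Bornology.IsBounded (B j))
    (hd : Pairwise fun i j => Disjoint (B i) (B j)) (φ : (ι → ℕ) → ℝ≥0∞) :
    ∑' c, φ c * P {ω | ∀ j, pointCount S (B j) ω = (c j : ℕ∞)} =
      ∫⁻ ω, ∫⁻ n, φ n ∂(Measure.pi fun j => poissonMeasure (Λ ω (B j)).toNNReal) ∂P := by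
  simp only [lintegral_countable', h.measure_pointCount_eq h𝓖 hB hb hd]
  rw [lintegral_tsum fun c => (h.aemeasurable_pi_poissonMeasure hB hb hd c).const_mul _]
  simp only [lintegral_const_mul'' _ (h.aemeasurable_pi_poissonMeasure hB hb hd _)]

lemma ae_finite_of_isBounded (h : IsCoxProcess 𝓖 P Λ S) (h𝓖 : 𝓖 ≤ mΩ) {B : Set ℝ}
    (hB : MeasurableSet B) (hb : Bornology.IsBounded B) : ∀ᵐ ω ∂P, {k | S k ω ∈ B}.Finite := by
  have hA : ∀ c : ℕ, MeasurableSet {ω | pointCount S B ω = (c : ℕ∞)} := fun c =>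
    measurable_pointCount h.measurable hB (measurableSet_singleton _)
  have hone : P (⋃ c : ℕ, {ω | pointCount S B ω = (c : ℕ∞)}) = 1 := by
    rw [measure_iUnion (fun c c' hcc => disjoint_left.2 fun ω hω hω' =>
      hcc (Nat.cast_injective (hω.symm.trans hω'))) hA]
    have := h.tsum_mul_measure_pointCount_eq h𝓖 (ι := Unit) (fun _ => hB) (fun _ => hb)
      (fun _ _ hij => (hij rfl).elim) 1
    rw [← (Equiv.funUnique Unit ℕ).symm.tsum_eq] at this
    simpa using this
  filter_upwards [mem_ae_iff.2 ((prob_compl_eq_zero_iff (.iUnion hA)).2 hone)] with ω hω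
  obtain ⟨c, hc⟩ := mem_iUnion.1 hω
  exact finite_of_encard_eq_coe hc

lemma lintegral_ncard (h : IsCoxProcess 𝓖 P Λ S) (h𝓖 : 𝓖 ≤ mΩ)
    (hB : ∀ j, MeasurableSet (B j)) (hb : ∀ j, Bornology.IsBounded (B j))
    (hd : Pairwise fun i j => Disjoint (B i) (B j)) (φ : (ι → ℕ) → ℝ≥0∞) :
    ∫⁻ ω, φ (fun j => {k | S k ω ∈ B j}.ncard) ∂P =
      ∫⁻ ω, ∫⁻ n, φ n ∂(Measure.pi fun j => poissonMeasure (Λ ω (B j)).toNNReal) ∂P := by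
  have hN : Measurable fun ω j => {k | S k ω ∈ B j}.ncard :=
    measurable_pi_lambda _ fun j => measurable_ncard h.measurable (hB j)
  rw [← h.tsum_mul_measure_pointCount_eq h𝓖 hB hb hd,
    ← lintegral_map (f := φ) .of_discrete hN, lintegral_countable']
  refine tsum_congr fun c => ?_
  rw [Measure.map_apply hN (measurableSet_singleton c)]
  refine congrArg _ (measure_congr ?_)
  filter_upwards [ae_all_iff.2 fun j => h.ae_finite_of_isBounded h𝓖 (hB j) (hb j)] with ω hω
  exact propext (funext_iff.trans (forall_congr' fun j => (pointCount_eq_coe_iff (hω j)).symm))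

lemma integral_prod_pow_ncard (h : IsCoxProcess 𝓖 P Λ S) (h𝓖 : 𝓖 ≤ mΩ)
    (hB : ∀ j, MeasurableSet (B j)) (hb : ∀ j, Bornology.IsBounded (B j))
    (hd : Pairwise fun i j => Disjoint (B i) (B j)) {p : ι → ℝ} (hp : ∀ j, p j ∈ Icc (0 : ℝ) 1) :
    ∫ ω, ∏ j, p j ^ {k | S k ω ∈ B j}.ncard ∂P =
      ∫ ω, Real.exp (-∑ j, (1 - p j) * (Λ ω).real (B j)) ∂P := by
  have hnonneg : ∀ n : ι → ℕ, 0 ≤ ∏ j, p j ^ n j := fun n =>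
    Finset.prod_nonneg fun j _ => pow_nonneg (hp j).1 _
  have hpoisson : ∀ ω, ∫⁻ n, ENNReal.ofReal (∏ j, p j ^ n j)
      ∂(Measure.pi fun j => poissonMeasure (Λ ω (B j)).toNNReal) =
      ENNReal.ofReal (Real.exp (-∑ j, (1 - p j) * (Λ ω).real (B j))) := fun ω => by
    rw [← ofReal_integral_eq_lintegral_ofReal _ (ae_of_all _ hnonneg),
      integral_fintype_prod_eq_prod (fun j (n : ℕ) => p j ^ n)]
    · simp only [integral_pow_poissonMeasure, ← Real.exp_sum, Finset.sum_neg_distrib]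
      rfl
    · refine .of_bound (C := 1) (Measurable.of_discrete.aestronglyMeasurable)
        (ae_of_all _ fun n => ?_)
      rw [Real.norm_of_nonneg (hnonneg n)]
      exact Finset.prod_le_one (fun j _ => pow_nonneg (hp j).1 _)
        fun j _ => pow_le_one₀ (hp j).1 (hp j).2
  rw [integral_eq_lintegral_of_nonneg_ae (ae_of_all _ fun ω => hnonneg _),
    integral_eq_lintegral_of_nonneg_ae (ae_of_all _ fun ω => (Real.exp_pos _).le),
    h.lintegral_ncard h𝓖 hB hb hd fun n => ENNReal.ofReal (∏ j, p j ^ n j)]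
  · simp only [hpoisson]
  · exact (Real.measurable_exp.comp_aemeasurable (Finset.aemeasurable_fun_sum _ fun j _ =>
      (h.aemeasurable_measureReal (hB j) (hb j)).const_mul _).neg).aestronglyMeasurable
  · exact (Finset.measurable_fun_prod _ fun j _ => (Measurable.of_discrete (f := (p j ^ ·))).comp
      (measurable_ncard h.measurable (hB j))).aestronglyMeasurable

end IsCoxProcess

section Finprod

lemma finprod_comp_eq_prod_pow_ncard {ι κ M : Type*} [CommMonoid M] (g : ι → κ) (φ : κ → M)
    {R : Finset κ} (hfin : {i | g i ∈ R}.Finite) (hR : ∀ i, g i ∉ R → φ (g i) = 1) :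
    ∏ᶠ i, φ (g i) = ∏ y ∈ R, φ y ^ {i | g i = y}.ncard := by
  classical
  rw [finprod_eq_prod_of_mulSupport_subset (s := hfin.toFinset) _ fun i hi =>
      hfin.mem_toFinset.2 (by_contra fun h => hi (hR _ h)),
    ← Finset.prod_fiberwise_of_maps_to' fun i hi => hfin.mem_toFinset.1 hi]
  refine Finset.prod_congr rfl fun y hy => ?_
  rw [Finset.prod_const, ← ncard_coe_finset]
  congr 2
  ext i
  simp only [Finset.coe_filter, Finite.mem_toFinset, mem_ofPred_eq, and_iff_right_iff_imp]
  rintro rfl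
  exact hy

lemma finprod_mem_Icc {ι : Type*} {x : ι → ℝ} (hx : ∀ i, x i ∈ Icc (0 : ℝ) 1) :
    ∏ᶠ i, x i ∈ Icc (0 : ℝ) 1 :=
  finprod_induction (· ∈ Icc (0 : ℝ) 1) ⟨zero_le_one, le_rfl⟩
    (fun _ _ ha hb => ⟨mul_nonneg ha.1 hb.1, mul_le_one₀ ha.2 hb.1 hb.2⟩) hx

lemma tendsto_finprod {ι κ : Type*} {l : Filter κ} {x : κ → ι → ℝ} {y : ι → ℝ} {K : Set ι}
    (hK : K.Finite) (hx : ∀ n, ∀ i ∉ K, x n i = 1) (hlim : ∀ i, Tendsto (x · i) l (𝓝 (y i)))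
    (hy : ∀ i ∉ K, y i = 1) :
    Tendsto (fun n => ∏ᶠ i, x n i) l (𝓝 (∏ᶠ i, y i)) := by
  have hprod : ∀ z : ι → ℝ, (∀ i ∉ K, z i = 1) → ∏ᶠ i, z i = ∏ i ∈ hK.toFinset, z i := fun z hz =>
    finprod_eq_prod_of_mulSupport_subset z fun i hi => by
      simpa using by_contra fun h => hi (hz i h)
  rw [hprod y hy, funext fun n => hprod (x n) (hx n)]
  exact tendsto_finsetProd _ fun i _ => hlim i

lemma aemeasurable_finprod {Ω : Type*} [MeasurableSpace Ω] {P : Measure Ω} {x : ℕ → Ω → ℝ}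
    (hx : ∀ k, AEMeasurable (x k) P) (hfin : ∀ᵐ ω ∂P, {k | x k ω ≠ 1}.Finite) :
    AEMeasurable (fun ω => ∏ᶠ k, x k ω) P := by
  refine aemeasurable_of_tendsto_metrizable_ae atTop
    (fun n => Finset.aemeasurable_fun_prod (Finset.range n) fun k _ => hx k) ?_
  filter_upwards [hfin] with ω hω
  rw [← tprod_eq_finprod (L := .unconditional ℕ)
    (show (fun k => x k ω).HasFiniteMulSupport from hω)]
  exact (multipliable_of_hasFiniteMulSupport (f := fun k => x k ω) hω).hasProd.tendsto_prod_nat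

end Finprod

namespace IsCoxProcess

variable {Ω : Type*} {𝓖 : MeasurableSpace Ω} [mΩ : MeasurableSpace Ω] {P : Measure Ω}
  {Λ : Ω → Measure ℝ} {S : ℕ → Ω → ℝ} {D : Set ℝ}

section SimpleFunc

variable {f : SimpleFunc ℝ ℝ}

lemma isBounded_preimage_singleton (hb : Bornology.IsBounded D) (hfD : ∀ s ∉ D, f s = 0) {y : ℝ}
    (hy : y ≠ 0) : Bornology.IsBounded (f ⁻¹' {y}) :=
  hb.subset fun s hs => by_contra fun hsD => hy (hs ▸ hfD s hsD)

lemma ae_integral_simpleFunc_eq (h : IsCoxProcess 𝓖 P Λ S) (hb : Bornology.IsBounded D)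
    (hfD : ∀ s ∉ D, f s = 0) :
    (fun ω => ∫ s, f s ∂Λ ω) =ᵐ[P]
      fun ω => ∑ y ∈ f.range with y ≠ 0, y * (Λ ω).real (f ⁻¹' {y}) := by
  filter_upwards [h.locallyFinite] with ω hω
  have hint : Integrable f (Λ ω) := SimpleFunc.integrable_iff.2 fun y hy =>
    (isBounded_preimage_singleton hb hfD hy).measure_lt_top
  rw [← f.integral_eq_integral hint, f.integral_eq_sum_filter]
  simp only [smul_eq_mul, mul_comm]

lemma aemeasurable_integral_simpleFunc (h : IsCoxProcess 𝓖 P Λ S) (hb : Bornology.IsBounded D)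
    (hfD : ∀ s ∉ D, f s = 0) : AEMeasurable (fun ω => ∫ s, f s ∂Λ ω) P := by
  refine AEMeasurable.congr (Finset.aemeasurable_fun_sum _ fun y hy => ?_)
    (h.ae_integral_simpleFunc_eq hb hfD).symm
  exact (h.aemeasurable_measureReal (f.measurableSet_preimage _)
    (isBounded_preimage_singleton hb hfD (Finset.mem_filter.1 hy).2)).const_mul y

lemma integral_finprod_one_sub_simpleFunc [IsProbabilityMeasure P] (h : IsCoxProcess 𝓖 P Λ S)
    (h𝓖 : 𝓖 ≤ mΩ) (hD : MeasurableSet D) (hb : Bornology.IsBounded D)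
    (hf : ∀ s, f s ∈ Icc (0 : ℝ) 1) (hfD : ∀ s ∉ D, f s = 0) :
    ∫ ω, ∏ᶠ k, (1 - f (S k ω)) ∂P = ∫ ω, Real.exp (-∫ s, f s ∂Λ ω) ∂P := by
  set R : Finset ℝ := {y ∈ f.range | y ≠ 0}
  have hR : ∀ y : R, (∃ s, f s = y) ∧ (y : ℝ) ≠ 0 := fun y =>
    ⟨f.mem_range.1 (Finset.mem_filter.1 y.2).1, (Finset.mem_filter.1 y.2).2⟩
  have hprod : ∀ᵐ ω ∂P,
      ∏ᶠ k, (1 - f (S k ω)) = ∏ y : R, (1 - y : ℝ) ^ {k | S k ω ∈ f ⁻¹' {↑y}}.ncard := by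
    filter_upwards [h.ae_finite_of_isBounded h𝓖 hD hb] with ω hω
    have hfin : {k | f (S k ω) ∈ R}.Finite := hω.subset fun k hk =>
      by_contra fun hkD => (Finset.mem_filter.1 hk).2 (hfD _ hkD)
    rw [finprod_comp_eq_prod_pow_ncard (fun k => f (S k ω)) (1 - ·) hfin fun k hk => ?_,
      ← Finset.prod_coe_sort]
    · rfl
    · have : f (S k ω) = 0 := by
        simpa only [R, Finset.mem_filter, f.mem_range_self, true_and, not_not] using hk
      rw [this, sub_zero]
  have hsum : ∀ᵐ ω ∂P, ∫ s, f s ∂Λ ω = ∑ y : R, (1 - (1 - y)) * (Λ ω).real (f ⁻¹' {↑y}) := by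
    filter_upwards [h.ae_integral_simpleFunc_eq hb hfD] with ω hω
    rw [hω, ← Finset.sum_coe_sort]
    simp only [sub_sub_cancel, R]
  rw [integral_congr_ae hprod, h.integral_prod_pow_ncard h𝓖 (fun y => f.measurableSet_preimage _)
    (fun y => isBounded_preimage_singleton hb hfD (hR y).2)
    (fun y z hyz => (disjoint_singleton.2 (Subtype.coe_ne_coe.2 hyz)).preimage f) fun y => ?_]
  · exact integral_congr_ae (hsum.mono fun ω hω => by simp only [hω])
  · obtain ⟨s, hs⟩ := (hR y).1
    exact ⟨sub_nonneg.2 (hs ▸ (hf s).2), sub_le_self _ (hs ▸ (hf s).1)⟩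

end SimpleFunc

end IsCoxProcess

lemma exists_simpleFunc_tendsto {f : ℝ → ℝ} {D : Set ℝ} (hf : Measurable f)
    (hf01 : ∀ s, f s ∈ Icc (0 : ℝ) 1) (hfD : ∀ s ∉ D, f s = 0) :
    ∃ g : ℕ → SimpleFunc ℝ ℝ, (∀ n s, g n s ∈ Icc (0 : ℝ) 1) ∧ (∀ n, ∀ s ∉ D, g n s = 0) ∧
      ∀ s, Tendsto (g · s) atTop (𝓝 (f s)) := by
  have h0 : (0 : ℝ) ∈ Icc (0 : ℝ) 1 := ⟨le_rfl, zero_le_one⟩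
  refine ⟨SimpleFunc.approxOn f hf (Icc 0 1) 0 h0, fun n s => SimpleFunc.approxOn_mem hf h0 n s,
    fun n s hs => ?_, fun s => SimpleFunc.tendsto_approxOn hf h0 (subset_closure (hf01 s))⟩
  have := SimpleFunc.edist_approxOn_y0_le hf h0 s n
  rw [hfD s hs, edist_self, add_zero] at this
  exact (edist_le_zero.1 this).symm

lemma tendsto_integral_of_mem_Icc {ν : Measure ℝ} {g : ℕ → SimpleFunc ℝ ℝ} {f : ℝ → ℝ} {D : Set ℝ}
    (hD : MeasurableSet D) (hν : ν D ≠ ∞) (hg01 : ∀ n s, g n s ∈ Icc (0 : ℝ) 1)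
    (hgD : ∀ n, ∀ s ∉ D, g n s = 0) (hgf : ∀ s, Tendsto (g · s) atTop (𝓝 (f s))) :
    Tendsto (fun n => ∫ s, g n s ∂ν) atTop (𝓝 (∫ s, f s ∂ν)) := by
  refine tendsto_integral_of_dominated_convergence (D.indicator fun _ => (1 : ℝ))
    (fun n => (g n).measurable.aestronglyMeasurable)
    ((integrable_indicator_iff hD).2 (integrableOn_const hν))
    (fun n => ae_of_all _ fun s => ?_) (ae_of_all _ hgf)
  rw [Real.norm_of_nonneg (hg01 n s).1]
  by_cases hs : s ∈ D
  · exact (hg01 n s).2.trans_eq (indicator_of_mem hs fun _ => (1 : ℝ)).symm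
  · exact (hgD n s hs).trans_le (indicator_nonneg (fun _ _ => zero_le_one) s)

namespace IsCoxProcess

variable {Ω : Type*} {𝓖 : MeasurableSpace Ω} [mΩ : MeasurableSpace Ω] {P : Measure Ω}
  [IsProbabilityMeasure P] {Λ : Ω → Measure ℝ} {S : ℕ → Ω → ℝ} {f : ℝ → ℝ}

lemma integral_finprod_one_sub (h : IsCoxProcess 𝓖 P Λ S) (h𝓖 : 𝓖 ≤ mΩ) {D : Set ℝ}
    (hD : MeasurableSet D) (hb : Bornology.IsBounded D) (hf : Measurable f)
    (hf01 : ∀ s, f s ∈ Icc (0 : ℝ) 1) (hfD : ∀ s ∉ D, f s = 0) :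
    ∫ ω, ∏ᶠ k, (1 - f (S k ω)) ∂P = ∫ ω, Real.exp (-∫ s, f s ∂Λ ω) ∂P := by
  obtain ⟨g, hg01, hgD, hgf⟩ := exists_simpleFunc_tendsto hf hf01 hfD
  have hfin := h.ae_finite_of_isBounded h𝓖 hD hb
  have hprod : Tendsto (fun n => ∫ ω, ∏ᶠ k, (1 - g n (S k ω)) ∂P) atTop
      (𝓝 (∫ ω, ∏ᶠ k, (1 - f (S k ω)) ∂P)) := by
    refine tendsto_integral_of_dominated_convergence 1 (fun n => ?_) (integrable_const 1)
      (fun n => ae_of_all _ fun ω => ?_) ?_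
    · refine (aemeasurable_finprod (fun k => (((g n).measurable.comp
        (h.measurable k)).const_sub 1).aemeasurable) ?_).aestronglyMeasurable
      filter_upwards [hfin] with ω hω
      exact hω.subset fun k hk => by_contra fun hkD => hk <| by
        simp only [Function.comp_apply, hgD n _ hkD, sub_zero]
    · have := finprod_mem_Icc fun k => Icc.mem_iff_one_sub_mem.1 (hg01 n (S k ω))
      exact (Real.norm_of_nonneg this.1).trans_le this.2
    · filter_upwards [hfin] with ω hω
      exact tendsto_finprod hω (fun n k hk => by rw [hgD n _ hk, sub_zero])
        (fun k => (hgf (S k ω)).const_sub 1) fun k hk => by rw [hfD _ hk, sub_zero]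
  have hexp : Tendsto (fun n => ∫ ω, Real.exp (-∫ s, g n s ∂Λ ω) ∂P) atTop
      (𝓝 (∫ ω, Real.exp (-∫ s, f s ∂Λ ω) ∂P)) := by
    refine tendsto_integral_of_dominated_convergence 1 (fun n => ?_) (integrable_const 1)
      (fun n => ae_of_all _ fun ω => ?_) ?_
    · exact (h.aemeasurable_integral_simpleFunc hb (hgD n)).neg.exp.aestronglyMeasurable
    · rw [Real.norm_of_nonneg (Real.exp_pos _).le]
      exact Real.exp_le_one_iff.2 (neg_nonpos.2 (integral_nonneg fun s => (hg01 n s).1))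
    · filter_upwards [h.locallyFinite] with ω hω
      exact (Real.continuous_exp.tendsto _).comp
        (tendsto_integral_of_mem_Icc hD hb.measure_lt_top.ne hg01 hgD hgf).neg
  refine tendsto_nhds_unique (hprod.congr fun n => ?_) hexp
  exact h.integral_finprod_one_sub_simpleFunc h𝓖 hD hb (hg01 n) (hgD n)

lemma ae_notMem_of_isBounded (h : IsCoxProcess 𝓖 P Λ S) (h𝓖 : 𝓖 ≤ mΩ) {B : Set ℝ}
    (hB : MeasurableSet B) (hb : Bornology.IsBounded B) (hnull : ∀ᵐ ω ∂P, Λ ω B = 0) :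
    ∀ᵐ ω ∂P, ∀ k, S k ω ∉ B := by
  have hvoid := h.measure_pointCount_eq h𝓖 (ι := Unit) (B := fun _ => B) (fun _ => hB)
    (fun _ => hb) (fun _ _ hij => (hij rfl).elim) 0
  have hone : P {ω | pointCount S B ω = 0} = 1 := by
    have hzero : ∀ᵐ ω ∂P, poissonMeasure (Λ ω B).toNNReal {0} = 1 := hnull.mono fun ω hω => by
      rw [hω, ← ofReal_measureReal, poissonMeasure_real_singleton]
      simp
    simpa [lintegral_congr_ae hzero] using hvoid
  filter_upwards [(mem_ae_iff_prob_eq_one (measurable_pointCount h.measurable hB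
    (measurableSet_singleton 0))).2 hone] with ω hω k hk
  exact notMem_empty k (encard_eq_zero.1 hω ▸ hk)

lemma ae_nonneg (h : IsCoxProcess 𝓖 P Λ S) (h𝓖 : 𝓖 ≤ mΩ) (hΛ : ∀ᵐ ω ∂P, Λ ω (Iio 0) = 0) :
    ∀ᵐ ω ∂P, ∀ k, 0 ≤ S k ω := by
  have hnotMem : ∀ m : ℕ, ∀ᵐ ω ∂P, ∀ k, S k ω ∉ Ico (-(m : ℝ)) 0 := fun m =>
    h.ae_notMem_of_isBounded h𝓖 measurableSet_Ico (Metric.isBounded_Ico _ _)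
      (hΛ.mono fun ω => measure_mono_null Ico_subset_Iio_self)
  filter_upwards [ae_all_iff.2 hnotMem] with ω hω k
  by_contra! hk
  obtain ⟨m, hm⟩ := exists_nat_ge (-S k ω)
  exact hω m k ⟨neg_le.1 hm, hk⟩

lemma ae_finite_le (h : IsCoxProcess 𝓖 P Λ S) (h𝓖 : 𝓖 ≤ mΩ) (hΛ : ∀ᵐ ω ∂P, Λ ω (Iio 0) = 0)
    (t : ℝ) : ∀ᵐ ω ∂P, {k | S k ω ≤ t}.Finite := by
  filter_upwards [h.ae_nonneg h𝓖 hΛ, h.ae_finite_of_isBounded h𝓖 measurableSet_Icc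
    (Metric.isBounded_Icc 0 t)] with ω hnonneg hfin
  exact hfin.subset fun k hk => ⟨hnonneg k, hk⟩

lemma integral_finprod_one_sub_of_le (h : IsCoxProcess 𝓖 P Λ S) (h𝓖 : 𝓖 ≤ mΩ)
    (hΛ : ∀ᵐ ω ∂P, Λ ω (Iio 0) = 0) (hf : Measurable f) (hf01 : ∀ s, f s ∈ Icc (0 : ℝ) 1) {t : ℝ}
    (hft : ∀ s, t < s → f s = 0) :
    ∫ ω, ∏ᶠ k, (1 - f (S k ω)) ∂P = ∫ ω, Real.exp (-∫ s, f s ∂Λ ω) ∂P := by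
  have hfD : ∀ s ∉ Icc 0 t, (Ici 0).indicator f s = 0 := fun s hs => by
    by_cases h0 : s ∈ Ici 0
    · rw [indicator_of_mem h0, hft s (not_le.1 fun hst => hs ⟨h0, hst⟩)]
    · exact indicator_of_notMem h0 f
  have hD := h.integral_finprod_one_sub h𝓖 measurableSet_Icc (Metric.isBounded_Icc 0 t)
    (hf.indicator measurableSet_Ici) (fun s => ?_) hfD
  · rw [integral_congr_ae (g := fun ω => ∏ᶠ k, (1 - (Ici 0).indicator f (S k ω))),
      hD, integral_congr_ae]
    · filter_upwards [hΛ] with ω hω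
      have hpos : ∀ᵐ s ∂Λ ω, s ∈ Ici 0 := mem_ae_iff.2 (compl_Ici (a := (0 : ℝ)) ▸ hω)
      have : (Ici 0).indicator f =ᵐ[Λ ω] f := hpos.mono fun s hs => indicator_of_mem hs f
      rw [integral_congr_ae this]
    · filter_upwards [h.ae_nonneg h𝓖 hΛ] with ω hω
      exact finprod_congr fun k => by rw [indicator_of_mem (s := Ici 0) (hω k)]
  · by_cases h0 : s ∈ Ici 0
    · rw [indicator_of_mem h0]; exact hf01 s
    · rw [indicator_of_notMem h0]; exact ⟨le_rfl, zero_le_one⟩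

end IsCoxProcess

section DelayedPoints

lemma coe_lt_coe_add_iff {t s : ℝ} {x : EReal} :
    (t : EReal) < (s : EReal) + x ↔ ((t - s : ℝ) : EReal) < x := by
  rw [EReal.coe_sub, EReal.sub_lt_iff (.inl (EReal.coe_ne_bot s)) (.inl (EReal.coe_ne_top s)),
    add_comm]

lemma coe_lt_iInf_coe_add_iff {s : ℕ → ℝ} {x : ℕ → EReal} {t : ℝ}
    (hs : {k | s k ≤ t + 1}.Finite) (hx : ∀ k, 0 ≤ x k) :
    (t : EReal) < ⨅ k, (s k : EReal) + x k ↔ ∀ k, ((t - s k : ℝ) : EReal) < x k := by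
  simp only [← coe_lt_coe_add_iff]
  refine ⟨fun hlt k => hlt.trans_le (iInf_le _ k), fun hlt => ?_⟩
  have hearly : (t : EReal) < hs.toFinset.inf fun k => (s k : EReal) + x k :=
    (Finset.lt_inf_iff (EReal.coe_lt_top t)).2 fun k _ => hlt k
  refine (lt_min hearly (EReal.coe_lt_coe_iff.2 (lt_add_one t))).trans_le (le_iInf fun k => ?_)
  by_cases hk : s k ≤ t + 1
  · exact (min_le_left _ _).trans (Finset.inf_le (hs.mem_toFinset.2 hk))
  · calc _ ≤ ((t + 1 : ℝ) : EReal) := min_le_right _ _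
      _ ≤ s k := EReal.coe_le_coe_iff.2 (not_le.1 hk).le
      _ ≤ s k + x k := le_add_of_nonneg_right (hx k)

lemma infinitePi_real_univ_pi {E : Type*} [MeasurableSpace E] {ν : ℕ → Measure E}
    [∀ k, IsProbabilityMeasure (ν k)] {A : ℕ → Set E} (hA : ∀ k, MeasurableSet (A k))
    (hfin : {k | ν k (A k) ≠ 1}.Finite) :
    (Measure.infinitePi ν).real (univ.pi A) = ∏ᶠ k, (ν k).real (A k) := by
  rw [measureReal_def, Measure.infinitePi_pi_univ ν hA,
    tprod_eq_finprod (L := .unconditional ℕ)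
      (show (fun k => ν k (A k)).HasFiniteMulSupport from hfin)]
  exact ENNReal.toRealHom.toMonoidHom.map_finprod hfin

lemma indepFun_real_eq_integral {Ω E F : Type*} [MeasurableSpace Ω] [MeasurableSpace E]
    [MeasurableSpace F] {P : Measure Ω} [IsProbabilityMeasure P] {U : Ω → E} {V : Ω → F}
    (hUV : IndepFun U V P) (hU : AEMeasurable U P) (hV : AEMeasurable V P) {A : Set (E × F)}
    (hA : MeasurableSet A) :
    P.real {ω | (U ω, V ω) ∈ A} = ∫ ω, (P.map V).real {v | (U ω, v) ∈ A} ∂P := by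
  have := Measure.isProbabilityMeasure_map hU
  have := Measure.isProbabilityMeasure_map hV
  have hsection : Measurable fun u => (P.map V) (Prod.mk u ⁻¹' A) :=
    measurable_measure_prodMk_left hA
  calc P.real {ω | (U ω, V ω) ∈ A}
    _ = (P.map fun ω => (U ω, V ω)).real A := by
      rw [measureReal_def, measureReal_def, Measure.map_apply_of_aemeasurable (hU.prodMk hV) hA]
      rfl
    _ = (∫⁻ u, (P.map V) (Prod.mk u ⁻¹' A) ∂P.map U).toReal := by
      rw [hUV.map_prod_eq_prod_map_map hU hV, measureReal_def, Measure.prod_apply hA]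
    _ = ∫ ω, (P.map V).real {v | (U ω, v) ∈ A} ∂P := by
      rw [lintegral_map' hsection.aemeasurable hU]
      exact (integral_toReal (hsection.comp_aemeasurable hU)
        (ae_of_all _ fun ω => measure_lt_top _ _)).symm

variable {Ω : Type*} [MeasurableSpace Ω] {P : Measure Ω} [IsProbabilityMeasure P]

lemma survival_of_neg {W : Ω → EReal} (hW : ∀ ω, 0 ≤ W ω) {t : ℝ} (ht : t < 0) :
    survival P W t = 1 := by
  have : {ω | (t : EReal) < W ω} = univ :=
    eq_univ_of_forall fun ω => (EReal.coe_neg'.2 ht).trans_le (hW ω)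
  rw [survival, this, probReal_univ]

lemma survival_iInf_add {S : ℕ → Ω → ℝ} {σ : ℕ → Ω → EReal}
    (hS : ∀ k, Measurable (S k)) (hσ : ∀ k, AEMeasurable (σ k) P) (hσ0 : ∀ k ω, 0 ≤ σ k ω)
    (hfin : ∀ t, ∀ᵐ ω ∂P, {k | S k ω ≤ t}.Finite) (hindep : iIndepFun σ P)
    (hSσ : IndepFun (fun ω k => S k ω) (fun ω k => σ k ω) P) (t : ℝ) :
    survival P (fun ω => ⨅ k, (S k ω : EReal) + σ k ω) t =
      ∫ ω, ∏ᶠ k, survival P (σ k) (t - S k ω) ∂P := by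
  have := fun k => Measure.isProbabilityMeasure_map (hσ k)
  have hA : MeasurableSet {q : (ℕ → ℝ) × (ℕ → EReal) | ∀ k, ((t - q.1 k : ℝ) : EReal) < q.2 k} := by
    rw [ofPred_forall]
    exact .iInter fun k => measurableSet_lt (by fun_prop) (by fun_prop)
  have hsurvival : ∀ k (u : ℝ), (P.map (σ k)).real (Ioi (u : EReal)) = survival P (σ k) u :=
    fun k u => map_measureReal_apply_of_aemeasurable (hσ k) measurableSet_Ioi
  calc survival P (fun ω => ⨅ k, (S k ω : EReal) + σ k ω) t
    _ = P.real {ω | ∀ k, ((t - S k ω : ℝ) : EReal) < σ k ω} := by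
      refine measureReal_congr ?_
      filter_upwards [hfin (t + 1)] with ω hω
      exact propext (coe_lt_iInf_coe_add_iff hω fun k => hσ0 k ω)
    _ = ∫ ω, (P.map fun ω k => σ k ω).real {x | ∀ k, ((t - S k ω : ℝ) : EReal) < x k} ∂P :=
      indepFun_real_eq_integral hSσ (measurable_pi_lambda _ hS).aemeasurable
        (aemeasurable_pi_iff.2 hσ) hA
    _ = ∫ ω, ∏ᶠ k, survival P (σ k) (t - S k ω) ∂P := by
      rw [(iIndepFun_iff_map_fun_eq_infinitePi_map₀' hσ).1 hindep]
      refine integral_congr_ae ?_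
      filter_upwards [hfin t] with ω hω
      have hpi : {x : ℕ → EReal | ∀ k, ((t - S k ω : ℝ) : EReal) < x k} =
        univ.pi fun k => Ioi ((t - S k ω : ℝ) : EReal) := by ext; simp
      rw [hpi, infinitePi_real_univ_pi fun _ => measurableSet_Ioi]
      · simp only [hsurvival]
      · refine hω.subset fun k hk => by_contra fun hkt => hk ?_
        rw [← ofReal_measureReal, hsurvival,
          survival_of_neg (hσ0 k) (sub_neg.2 (not_le.1 hkt)), ENNReal.ofReal_one]

end DelayedPoints

namespace IsCoxProcess

variable {Ω : Type*} {𝓖 : MeasurableSpace Ω} [mΩ : MeasurableSpace Ω] {P : Measure Ω}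
  [IsProbabilityMeasure P] {Λ : Ω → Measure ℝ} {S : ℕ → Ω → ℝ}

lemma survival_iInf_add {σ : ℕ → Ω → EReal} (h : IsCoxProcess 𝓖 P Λ S) (h𝓖 : 𝓖 ≤ mΩ)
    (hΛ : ∀ᵐ ω ∂P, Λ ω (Iio 0) = 0) (hσ : ∀ k, AEMeasurable (σ k) P)
    (hσ0 : ∀ k ω, 0 ≤ σ k ω) (hindep : iIndepFun σ P)
    (hSσ : IndepFun (fun ω k => S k ω) (fun ω k => σ k ω) P) {F : ℝ → ℝ} (hF : Measurable F)
    (hσF : ∀ k u, survival P (σ k) u = 1 - F u) (t : ℝ) :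
    survival P (fun ω => ⨅ k, (S k ω : EReal) + σ k ω) t =
      ∫ ω, Real.exp (-∫ s, F (t - s) ∂Λ ω) ∂P := by
  have hF01 : ∀ u, F u ∈ Icc (0 : ℝ) 1 := fun u =>
    Icc.mem_iff_one_sub_mem.2 (hσF 0 u ▸ ⟨measureReal_nonneg, measureReal_le_one⟩)
  have hFneg : ∀ u < 0, F u = 0 := fun u hu => by
    linarith [hσF 0 u, survival_of_neg (P := P) (hσ0 0) hu]
  rw [ShotNoise.survival_iInf_add h.measurable hσ hσ0 (h.ae_finite_le h𝓖 hΛ) hindep hSσ]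
  simp only [hσF]
  exact h.integral_finprod_one_sub_of_le h𝓖 hΛ (hF.comp (measurable_const.sub measurable_id))
    (fun s => hF01 (t - s)) (t := t) fun s hs => hFneg _ (sub_neg.2 hs)

end IsCoxProcess

section Hitting

variable {Ω : Type*} [MeasurableSpace Ω] {P : Measure Ω} [IsProbabilityMeasure P] {L : ℝ}

lemma survival_hittingTime {X : ℝ≥0 → Ω → ℝ} (hX : AEMeasurable (hittingTime L X) P) (t : ℝ) :
    survival P (hittingTime L X) t = 1 - hittingCDF P L X t := by
  have hcompl : {ω | (t : EReal) < hittingTime L X ω} = {ω | hittingTime L X ω ≤ t}ᶜ := by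
    ext ω
    exact (not_le (a := hittingTime L X ω) (b := (t : EReal))).symm
  rw [survival, hcompl]
  exact probReal_compl_eq_one_sub₀ (hX.nullMeasurableSet_preimage measurableSet_Iic)

end Hitting

namespace IsModel

variable {Ω : Type*} [mΩ : MeasurableSpace Ω] {P : Measure Ω} {lam μ δ α β L : ℝ}
  {T S : ℕ → Ω → ℝ} {X : ℕ → ℝ≥0 → Ω → ℝ}

lemma comap_shocks_le (h : IsModel P lam μ δ α β T S X) :
    MeasurableSpace.comap (fun ω i => T i ω) inferInstance ≤ mΩ :=
  (measurable_pi_lambda _ h.shocks.measurable).comap_le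

lemma iIndepFun_hittingTime (h : IsModel P lam μ δ α β T S X) (L : ℝ) :
    iIndepFun (fun k => hittingTime L (X k)) P :=
  (h.growth_indep.comp (fun _ => denseHittingTime L) fun _ => measurable_denseHittingTime L).congr
    fun k => (h.growth k).ae_denseHittingTime_eq

lemma indepFun_starts_hittingTime (h : IsModel P lam μ δ α β T S X) (L : ℝ) :
    IndepFun (fun ω k => S k ω) (fun ω k => hittingTime L (X k) ω) P := by
  have hdense : Measurable fun (x : ℕ → ℝ≥0 → ℝ) k => denseHittingTime L (x k) :=
    measurable_pi_lambda _ fun k => (measurable_denseHittingTime L).comp (measurable_pi_apply k)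
  refine (h.indep.comp measurable_snd hdense).congr .rfl ?_
  filter_upwards [ae_all_iff.2 fun k => (h.growth k).ae_denseHittingTime_eq (L := L)] with ω hω
  exact funext hω

lemma aemeasurable_failureTime (h : IsModel P lam μ δ α β T S X) :
    AEMeasurable (failureTime L S X) P :=
  .iInf fun k => (h.starts.measurable k).coe_real_ereal.aemeasurable.add
    (h.growth k).aemeasurable_hittingTime

end IsModel

/-- The convolution over `[0, x]` of `F` with the exponential decay of rate `δ`. -/
noncomputable def expConv (δ : ℝ) (F : ℝ → ℝ) (x : ℝ) : ℝ :=
  ∫ w in (0 : ℝ)..x, Real.exp (-δ * w) * F (x - w)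

section ExpConv

variable {δ : ℝ} {F : ℝ → ℝ}

lemma continuous_expConv (hF : Continuous F) : Continuous (expConv δ F) :=
  intervalIntegral.continuous_parametric_intervalIntegral_of_continuous
    (f := fun x w => Real.exp (-δ * w) * F (x - w)) (by fun_prop) continuous_id

lemma expConv_of_neg (hneg : ∀ x < 0, F x = 0) {x : ℝ} (hx : x < 0) : expConv δ F x = 0 :=
  intervalIntegral.integral_zero_ae (ae_of_all _ fun w hw => by
    rw [hneg _ (sub_neg.2 (uIoc_of_ge hx.le ▸ hw).1), mul_zero])

lemma expConv_nonneg (hF0 : ∀ x, 0 ≤ F x) (hneg : ∀ x < 0, F x = 0) (x : ℝ) :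
    0 ≤ expConv δ F x := by
  rcases lt_or_ge x 0 with hx | hx
  · exact (expConv_of_neg hneg hx).ge
  · exact intervalIntegral.integral_nonneg hx fun _ _ => mul_nonneg (Real.exp_pos _).le (hF0 _)

lemma monotoneOn_expConv (hF : Continuous F) (hF0 : ∀ x, 0 ≤ F x) (hmono : Monotone F) :
    MonotoneOn (expConv δ F) (Ici 0) := by
  intro x (hx : 0 ≤ x) y _ hxy
  have hint : ∀ z a b, IntervalIntegrable (fun w => Real.exp (-δ * w) * F (z - w)) volume a b :=
    fun z a b => (by fun_prop : Continuous _).intervalIntegrable a b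
  calc expConv δ F x
    _ ≤ ∫ w in (0 : ℝ)..x, Real.exp (-δ * w) * F (y - w) := by
      refine intervalIntegral.integral_mono_on hx (hint _ _ _) (hint _ _ _) fun w _ => ?_
      gcongr
      exact hmono (sub_le_sub_right hxy w)
    _ ≤ expConv δ F y :=
      intervalIntegral.integral_mono_interval le_rfl hx hxy
        (ae_of_all _ fun w => mul_nonneg (Real.exp_pos _).le (hF0 _)) (hint _ _ _)

lemma expConv_eq_integral_Ioi (hneg : ∀ x < 0, F x = 0) {x : ℝ} (hx : 0 ≤ x) :
    expConv δ F x = ∫ w in Ioi 0, Real.exp (-δ * w) * F (x - w) := by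
  rw [expConv, intervalIntegral.integral_of_le hx]
  refine (setIntegral_eq_of_subset_of_forall_sdiff_eq_zero measurableSet_Ioi Ioc_subset_Ioi_self
    fun w hw => ?_).symm
  rw [hneg _ (sub_neg.2 (not_le.1 fun hwx => hw.2 ⟨hw.1, hwx⟩)), mul_zero]

lemma tendsto_expConv (hδ : 0 < δ) (hF : Measurable F) (hF01 : ∀ x, F x ∈ Icc (0 : ℝ) 1)
    (hneg : ∀ x < 0, F x = 0) (hlim : Tendsto F atTop (𝓝 1)) :
    Tendsto (expConv δ F) atTop (𝓝 (1 / δ)) := by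
  have hmass : ∫ w in Ioi (0 : ℝ), Real.exp (-δ * w) * 1 = 1 / δ := by
    simp only [mul_one]
    rw [integral_exp_mul_Ioi (neg_neg_of_pos hδ), mul_zero, Real.exp_zero, neg_div_neg_eq]
  have hlimit : Tendsto (fun x => ∫ w in Ioi 0, Real.exp (-δ * w) * F (x - w)) atTop
      (𝓝 (1 / δ)) := by
    rw [← hmass]
    refine tendsto_integral_filter_of_dominated_convergence (fun w => Real.exp (-δ * w))
      (.of_forall fun x => (by fun_prop : Measurable _).aestronglyMeasurable)
      (.of_forall fun x => ae_of_all _ fun w => ?_) (exp_neg_integrableOn_Ioi 0 hδ)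
      (ae_of_all _ fun w => ?_)
    · rw [Real.norm_of_nonneg (mul_nonneg (Real.exp_pos _).le (hF01 _).1)]
      exact mul_le_of_le_one_right (Real.exp_pos _).le (hF01 _).2
    · exact (hlim.comp (tendsto_atTop_add_const_right _ (-w) tendsto_id)).const_mul _
  refine hlimit.congr' ?_
  filter_upwards [eventually_ge_atTop 0] with x hx using (expConv_eq_integral_Ioi hneg hx).symm

end ExpConv

/-- The contribution at time `s` of a shock at time `x` to the shot noise intensity. -/
noncomputable def shot (δ x s : ℝ) : ℝ :=
  (Ici x).indicator (fun s => Real.exp (-δ * (s - x))) s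

section Shot

variable {δ x : ℝ}

lemma shot_nonneg (s : ℝ) : 0 ≤ shot δ x s :=
  indicator_nonneg (fun _ _ => (Real.exp_pos _).le) s

lemma measurable_shot : Measurable (shot δ x) :=
  Measurable.indicator (by fun_prop) measurableSet_Ici

lemma shot_mul_eq_indicator (g : ℝ → ℝ) (s : ℝ) :
    shot δ x s * g s = (Ici x).indicator (fun s => Real.exp (-δ * (s - x)) * g s) s :=
  (indicator_mul_left (Ici x) (fun s => Real.exp (-δ * (s - x))) g).symm

lemma integrableOn_shot_mul {g : ℝ → ℝ} (hg : Continuous g) (a b : ℝ) :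
    IntegrableOn (fun s => shot δ x s * g s) (Icc a b) := by
  simp only [shot_mul_eq_indicator]
  exact Integrable.indicator (by fun_prop : Continuous _).integrableOn_Icc measurableSet_Ici

lemma setIntegral_shot_mul (F : ℝ → ℝ) {t : ℝ} (hx : x ∈ Icc 0 t) :
    ∫ s in Icc 0 t, shot δ x s * F (t - s) = expConv δ F (t - x) := by
  have hinter : Icc 0 t ∩ Ici x = Icc x t := by
    rw [← Ici_inter_Iic, inter_right_comm, Ici_inter_Ici, sup_of_le_right hx.1, Ici_inter_Iic]
  have hshift := intervalIntegral.integral_comp_sub_right (a := x) (b := t)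
    (fun w => Real.exp (-δ * w) * F (t - x - w)) x
  simp only [sub_sub_sub_cancel_right, sub_self] at hshift
  simp only [shot_mul_eq_indicator fun s => F (t - s)]
  rw [setIntegral_indicator measurableSet_Ici, hinter, integral_Icc_eq_integral_Ioc,
    ← intervalIntegral.integral_of_le hx.2, hshift, expConv]

end Shot

section IntensityMeasure

variable {Ω : Type*} {lam δ t : ℝ} {T : ℕ → Ω → ℝ} {ω : Ω}

lemma restrict_Ici_Iio : (volume.restrict (Ici (0 : ℝ))) (Iio 0) = 0 := by
  rw [Measure.restrict_apply measurableSet_Iio, Iio_inter_Ici, Ico_self, measure_empty]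

lemma smul_restrict_Ici_Iio (c : ℝ≥0∞) : (c • volume.restrict (Ici (0 : ℝ))) (Iio 0) = 0 := by
  rw [Measure.smul_apply, restrict_Ici_Iio, smul_zero]

lemma intensityMeasure_Iio : intensityMeasure lam δ T ω (Iio 0) = 0 :=
  withDensity_absolutelyContinuous _ _ restrict_Ici_Iio

lemma intensity_eq_ofReal (hlam : 0 ≤ lam) (hfin : {i | T i ω ≤ t}.Finite) {s : ℝ} (hs : s ≤ t) :
    intensity lam δ T ω s =
      ENNReal.ofReal (lam + ∑ i ∈ hfin.toFinset, shot δ (T i ω) s) := by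
  rw [intensity, ENNReal.ofReal_add hlam (Finset.sum_nonneg fun i _ => shot_nonneg s),
    ENNReal.ofReal_sum_of_nonneg fun i _ => shot_nonneg s, tsum_eq_sum (s := hfin.toFinset)]
  · simp only [shot, indicator_apply, mem_Ici, apply_ite ENNReal.ofReal, ENNReal.ofReal_zero]
  · exact fun i hi => if_neg fun hle => hi (hfin.mem_toFinset.2 (hle.trans hs))

lemma restrict_Iic_intensityMeasure (hlam : 0 ≤ lam) (hfin : {i | T i ω ≤ t}.Finite) :
    (intensityMeasure lam δ T ω).restrict (Iic t) = (volume.restrict (Icc 0 t)).withDensity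
      fun s => ENNReal.ofReal (lam + ∑ i ∈ hfin.toFinset, shot δ (T i ω) s) := by
  rw [intensityMeasure, restrict_withDensity measurableSet_Iic,
    Measure.restrict_restrict measurableSet_Iic, inter_comm, Ici_inter_Iic]
  exact withDensity_congr_ae ((ae_restrict_mem measurableSet_Icc).mono fun s hs =>
    intensity_eq_ofReal hlam hfin hs.2)

lemma integral_intensityMeasure (hlam : 0 ≤ lam) (ht : 0 ≤ t) (hT : ∀ i, 0 ≤ T i ω)
    (hfin : {i | T i ω ≤ t}.Finite) {F : ℝ → ℝ} (hF : Continuous F) (hneg : ∀ x < 0, F x = 0) :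
    ∫ s, F (t - s) ∂intensityMeasure lam δ T ω =
      lam * (∫ u in (0 : ℝ)..t, F u) + ∑ i ∈ hfin.toFinset, expConv δ F (t - T i ω) := by
  have hcont : Continuous fun s => F (t - s) := by fun_prop
  have hshot := fun i (_ : i ∈ hfin.toFinset) =>
    integrableOn_shot_mul (δ := δ) (x := T i ω) hcont 0 t
  have hdensity : Measurable fun s =>
      ENNReal.ofReal (lam + ∑ i ∈ hfin.toFinset, shot δ (T i ω) s) :=
    (measurable_const.add (Finset.measurable_fun_sum _ fun i _ => measurable_shot)).ennreal_ofReal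
  rw [← setIntegral_eq_integral_of_forall_compl_eq_zero (s := Iic t) fun s hs =>
      hneg _ (sub_neg.2 (not_le.1 hs)),
    restrict_Iic_intensityMeasure hlam hfin, integral_withDensity_eq_integral_toReal_smul
      hdensity (ae_of_all _ fun s => ENNReal.ofReal_lt_top)]
  simp only [smul_eq_mul, add_mul, Finset.sum_mul, ENNReal.toReal_ofReal
    (add_nonneg hlam (Finset.sum_nonneg fun _ _ => shot_nonneg _))]
  rw [integral_add (hcont.integrableOn_Icc.const_mul lam) (integrable_finsetSum _ hshot),
    integral_const_mul, integral_finsetSum _ hshot, integral_Icc_eq_integral_Ioc,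
    ← intervalIntegral.integral_of_le ht, intervalIntegral.integral_comp_sub_left, sub_self,
    sub_zero]
  exact congrArg _ (Finset.sum_congr rfl fun i hi =>
    setIntegral_shot_mul F ⟨hT i, hfin.mem_toFinset.1 hi⟩)

end IntensityMeasure

namespace IsPoissonProcess

variable {Ω : Type*} [MeasurableSpace Ω] {P : Measure Ω} [IsProbabilityMeasure P] {μ : ℝ}
  {T : ℕ → Ω → ℝ}

lemma ae_nonneg (h : IsPoissonProcess P (ENNReal.ofReal μ • volume.restrict (Ici 0)) T) :
    ∀ᵐ ω ∂P, ∀ i, 0 ≤ T i ω :=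
  IsCoxProcess.ae_nonneg h bot_le (ae_of_all _ fun _ => smul_restrict_Ici_Iio _)

lemma ae_finite_le (h : IsPoissonProcess P (ENNReal.ofReal μ • volume.restrict (Ici 0)) T)
    (t : ℝ) : ∀ᵐ ω ∂P, {i | T i ω ≤ t}.Finite :=
  IsCoxProcess.ae_finite_le h bot_le (ae_of_all _ fun _ => smul_restrict_Ici_Iio _) t

lemma integral_finprod_one_sub
    (h : IsPoissonProcess P (ENNReal.ofReal μ • volume.restrict (Ici 0)) T) (hμ : 0 ≤ μ)
    {t : ℝ} (ht : 0 ≤ t) {f : ℝ → ℝ} (hf : Measurable f) (hf01 : ∀ u, f u ∈ Icc (0 : ℝ) 1)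
    (hneg : ∀ u < 0, f u = 0) :
    ∫ ω, ∏ᶠ i, (1 - f (t - T i ω)) ∂P = Real.exp (-(μ * ∫ u in (0 : ℝ)..t, f u)) := by
  have hvanish : ∀ s, t < s → f (t - s) = 0 := fun s hs => hneg _ (sub_neg.2 hs)
  have hmean : ∫ s in Ici 0, f (t - s) = ∫ u in (0 : ℝ)..t, f u := by
    rw [setIntegral_eq_of_subset_of_forall_sdiff_eq_zero measurableSet_Ici Icc_subset_Ici_self
        fun s hs => hvanish s (not_le.1 fun hst => hs.2 ⟨hs.1, hst⟩),
      integral_Icc_eq_integral_Ioc, ← intervalIntegral.integral_of_le ht,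
      intervalIntegral.integral_comp_sub_left, sub_self, sub_zero]
  rw [IsCoxProcess.integral_finprod_one_sub_of_le h bot_le
      (ae_of_all _ fun _ => smul_restrict_Ici_Iio _) (f := fun s => f (t - s)) (by fun_prop)
      (fun s => hf01 (t - s)) hvanish,
    integral_const, probReal_univ, one_smul, integral_smul_measure, ENNReal.toReal_ofReal hμ,
    smul_eq_mul, hmean]

end IsPoissonProcess

/-- The failure rate of the shot noise model whose hitting times have the distribution function
`F`. -/
noncomputable def hazard (lam μ δ : ℝ) (F : ℝ → ℝ) (t : ℝ) : ℝ :=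
  lam * F t + μ * (1 - Real.exp (-expConv δ F t))

section Hazard

variable {lam μ δ : ℝ} {F : ℝ → ℝ}

lemma continuous_hazard (hF : Continuous F) : Continuous (hazard lam μ δ F) := by
  have := continuous_expConv (δ := δ) hF
  unfold hazard
  fun_prop

lemma monotoneOn_hazard (hlam : 0 ≤ lam) (hμ : 0 ≤ μ) (hF : Continuous F) (hF0 : ∀ x, 0 ≤ F x)
    (hmono : Monotone F) : MonotoneOn (hazard lam μ δ F) (Ici 0) := by
  intro x hx y hy hxy
  have hF_le := hmono hxy
  have hconv_le := monotoneOn_expConv (δ := δ) hF hF0 hmono hx hy hxy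
  unfold hazard
  gcongr

lemma tendsto_hazard (hδ : 0 < δ) (hF : Measurable F) (hF01 : ∀ x, F x ∈ Icc (0 : ℝ) 1)
    (hneg : ∀ x < 0, F x = 0) (hlim : Tendsto F atTop (𝓝 1)) :
    Tendsto (hazard lam μ δ F) atTop (𝓝 (lam + μ * (1 - Real.exp (-1 / δ)))) := by
  have hsum := (hlim.const_mul lam).add
    (((tendsto_expConv hδ hF hF01 hneg hlim).neg.rexp.const_sub 1).const_mul μ)
  rwa [mul_one, ← neg_div] at hsum

lemma hazard_limit_pos (hlam : 0 < lam) (hμ : 0 ≤ μ) (hδ : 0 < δ) :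
    0 < lam + μ * (1 - Real.exp (-1 / δ)) :=
  add_pos_of_pos_of_nonneg hlam (mul_nonneg hμ (sub_nonneg.2 (Real.exp_le_one_iff.2
    (div_nonpos_of_nonpos_of_nonneg (by norm_num) hδ.le))))

lemma integral_exp_neg_integral_intensityMeasure {Ω : Type*} [MeasurableSpace Ω]
    {P : Measure Ω} [IsProbabilityMeasure P] {T : ℕ → Ω → ℝ}
    (hT : IsPoissonProcess P (ENNReal.ofReal μ • volume.restrict (Ici 0)) T) (hlam : 0 ≤ lam)
    (hμ : 0 ≤ μ) (hF : Continuous F) (hF0 : ∀ x, 0 ≤ F x) (hneg : ∀ x < 0, F x = 0) {t : ℝ}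
    (ht : 0 ≤ t) :
    ∫ ω, Real.exp (-∫ s, F (t - s) ∂intensityMeasure lam δ T ω) ∂P =
      Real.exp (-∫ u in (0 : ℝ)..t, hazard lam μ δ F u) := by
  have hconv := continuous_expConv (δ := δ) hF
  have hconv0 := expConv_nonneg (δ := δ) hF0 hneg
  have hpath : ∀ᵐ ω ∂P, Real.exp (-∫ s, F (t - s) ∂intensityMeasure lam δ T ω) =
      Real.exp (-(lam * ∫ u in (0 : ℝ)..t, F u)) *
        ∏ᶠ i, (1 - (1 - Real.exp (-expConv δ F (t - T i ω)))) := by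
    filter_upwards [hT.ae_nonneg, hT.ae_finite_le t] with ω hω hfin
    rw [integral_intensityMeasure hlam ht hω hfin hF hneg, neg_add, Real.exp_add,
      ← Finset.sum_neg_distrib, Real.exp_sum,
      finprod_eq_prod_of_mulSupport_subset (s := hfin.toFinset)]
    · simp only [sub_sub_cancel]
    · rw [Finite.coe_toFinset]
      refine fun i hi => not_lt.1 fun hlt : t < T i ω => hi ?_
      simp only [expConv_of_neg hneg (sub_neg.2 hlt), neg_zero, Real.exp_zero, sub_self, sub_zero]
  rw [integral_congr_ae hpath, integral_const_mul,
    hT.integral_finprod_one_sub hμ ht (f := fun u => 1 - Real.exp (-expConv δ F u)) (by fun_prop)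
      (fun u => ⟨sub_nonneg.2 (Real.exp_le_one_iff.2 (neg_nonpos.2 (hconv0 u))),
        sub_le_self _ (Real.exp_pos _).le⟩)
      (fun u hu => by rw [expConv_of_neg hneg hu, neg_zero, Real.exp_zero, sub_self]),
    ← Real.exp_add, ← neg_add, ← intervalIntegral.integral_const_mul,
    ← intervalIntegral.integral_const_mul, ← intervalIntegral.integral_add
      ((by fun_prop : Continuous _).intervalIntegrable _ _)
      ((by fun_prop : Continuous _).intervalIntegrable _ _)]
  rfl

end Hazard

/-- The random time `W` survives beyond `t ≥ 0` with probability `exp (-∫₀ᵗ r)`: it has the failure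
rate `r`, in integrated form. -/
def HasHazardRate {Ω : Type*} [MeasurableSpace Ω] (P : Measure Ω) (W : Ω → EReal) (r : ℝ → ℝ) :
    Prop :=
  ∀ t, 0 ≤ t → survival P W t = Real.exp (-∫ u in (0 : ℝ)..t, r u)

lemma tendsto_integral_atTop {r : ℝ → ℝ} {c : ℝ} (hr : Continuous r) (hc : 0 < c)
    (hlim : Tendsto r atTop (𝓝 c)) : Tendsto (fun t => ∫ u in (0 : ℝ)..t, r u) atTop atTop := by
  obtain ⟨a, ha⟩ := eventually_atTop.1 (hlim.eventually (lt_mem_nhds (half_lt_self hc)))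
  have hlinear : Tendsto (fun t => (∫ u in (0 : ℝ)..a, r u) + c / 2 * (t - a)) atTop atTop :=
    tendsto_atTop_add_const_left _ _
      ((tendsto_atTop_add_const_right _ (-a) tendsto_id).const_mul_atTop (half_pos hc))
  refine tendsto_atTop_mono' _ ?_ hlinear
  filter_upwards [eventually_ge_atTop a] with t ht
  rw [← intervalIntegral.integral_add_adjacent_intervals (hr.intervalIntegrable 0 a)
    (hr.intervalIntegrable a t)]
  gcongr
  calc c / 2 * (t - a) = ∫ _ in a..t, c / 2 := by
        rw [intervalIntegral.integral_const, smul_eq_mul, mul_comm]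
    _ ≤ ∫ u in a..t, r u :=
        intervalIntegral.integral_mono_on ht intervalIntegrable_const (hr.intervalIntegrable a t)
          fun u hu => (ha u hu.1).le

namespace HasHazardRate

variable {Ω : Type*} [MeasurableSpace Ω] {P : Measure Ω} {W : Ω → EReal} {r : ℝ → ℝ}

lemma survival_pos (h : HasHazardRate P W r) {t : ℝ} (ht : 0 ≤ t) : 0 < survival P W t :=
  h t ht ▸ Real.exp_pos _

lemma hasDerivWithinAt_survival (h : HasHazardRate P W r) (hr : Continuous r) {t : ℝ}
    (ht : 0 ≤ t) :
    HasDerivWithinAt (survival P W) (-(r t * survival P W t)) (Ici 0) t := by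
  have hexp := (hr.integral_hasStrictDerivAt 0 t).hasDerivAt.fun_neg.exp.hasDerivWithinAt
    (s := Ici 0)
  refine (hexp.congr h (h t ht)).congr_deriv ?_
  rw [h t ht]
  ring

lemma failureRate_eq (h : HasHazardRate P W r) (hr : Continuous r) {t : ℝ} (ht : 0 ≤ t) :
    failureRate P W t = r t := by
  rw [failureRate, (h.hasDerivWithinAt_survival hr ht).derivWithin (uniqueDiffOn_Ici 0 t ht),
    neg_neg, mul_div_cancel_right₀ _ (h.survival_pos ht).ne']

lemma monotoneOn_failureRate (h : HasHazardRate P W r) (hr : Continuous r)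
    (hmono : MonotoneOn r (Ici 0)) : MonotoneOn (failureRate P W) (Ici 0) :=
  hmono.congr fun _ ht => (h.failureRate_eq hr ht).symm

lemma tendsto_failureRate (h : HasHazardRate P W r) (hr : Continuous r) {c : ℝ}
    (hlim : Tendsto r atTop (𝓝 c)) : Tendsto (failureRate P W) atTop (𝓝 c) := by
  refine hlim.congr' ?_
  filter_upwards [eventually_ge_atTop 0] with t ht using (h.failureRate_eq hr ht).symm

lemma ae_lt_top [IsFiniteMeasure P] (h : HasHazardRate P W r) (hr : Continuous r) {c : ℝ}
    (hc : 0 < c) (hlim : Tendsto r atTop (𝓝 c)) : ∀ᵐ ω ∂P, W ω < ⊤ := by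
  have hsurvival : Tendsto (survival P W) atTop (𝓝 0) := by
    refine (Real.tendsto_exp_neg_atTop_nhds_zero.comp (tendsto_integral_atTop hr hc hlim)).congr' ?_
    filter_upwards [eventually_ge_atTop 0] with t ht using (h t ht).symm
  have hle : P.real {ω | W ω = ⊤} ≤ 0 :=
    ge_of_tendsto' hsurvival fun t => measureReal_mono fun ω (hω : W ω = ⊤) =>
      (EReal.coe_lt_top t).trans_eq hω.symm
  have hzero := (measureReal_eq_zero_iff).1 (hle.antisymm measureReal_nonneg)
  filter_upwards [measure_eq_zero_iff_ae_notMem.1 hzero] with ω hω using lt_top_iff_ne_top.2 hω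

lemma isIFR [IsFiniteMeasure P] (h : HasHazardRate P W r) (hW : AEMeasurable W P)
    (hW0 : ∀ᵐ ω ∂P, 0 ≤ W ω) (hr : Continuous r) (hmono : MonotoneOn r (Ici 0)) {c : ℝ}
    (hc : 0 < c) (hlim : Tendsto r atTop (𝓝 c)) : IsIFR P W where
  aemeasurable := hW
  nonneg_finite := hW0.and (h.ae_lt_top hr hc hlim)
  differentiable _ ht _ := (h.hasDerivWithinAt_survival hr ht).differentiableWithinAt
  monotone := (h.monotoneOn_failureRate hr hmono).mono fun _ ht => ht.1

end HasHazardRate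

namespace IsModel

variable {Ω : Type*} [MeasurableSpace Ω] {P : Measure Ω} [IsProbabilityMeasure P]
  {lam μ δ α β L : ℝ} {T S : ℕ → Ω → ℝ} {X : ℕ → ℝ≥0 → Ω → ℝ}

lemma ae_failureTime_nonneg (h : IsModel P lam μ δ α β T S X) :
    ∀ᵐ ω ∂P, 0 ≤ failureTime L S X ω := by
  filter_upwards [h.starts.ae_nonneg h.comap_shocks_le (ae_of_all _ fun _ => intensityMeasure_Iio)]
    with ω hω
  exact le_iInf fun k => add_nonneg (EReal.coe_nonneg.2 (hω k)) (hittingTime_nonneg L (X k) ω)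

lemma hasHazardRate_failureTime (h : IsModel P lam μ δ α β T S X) (hlam : 0 ≤ lam) (hμ : 0 ≤ μ)
    (hα : 0 < α) (hβ : 0 < β) (hL : 0 < L) (k : ℕ) :
    HasHazardRate P (failureTime L S X) (hazard lam μ δ (hittingCDF P L (X k))) := by
  intro t ht
  have hF := (h.growth k).continuous_hittingCDF hα hβ hL
  have hσ := fun j => (h.growth j).aemeasurable_hittingTime (L := L)
  have hcdf : ∀ j u, survival P (hittingTime L (X j)) u = 1 - hittingCDF P L (X k) u :=
    fun j u => by
      rw [survival_hittingTime (hσ j), (h.growth j).hittingCDF_eq hα hβ hL,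
        (h.growth k).hittingCDF_eq hα hβ hL]
  unfold failureTime
  rw [h.starts.survival_iInf_add h.comap_shocks_le (ae_of_all _ fun _ => intensityMeasure_Iio) hσ
      (fun j => hittingTime_nonneg L (X j)) (h.iIndepFun_hittingTime L)
      (h.indepFun_starts_hittingTime L) hF.measurable hcdf,
    integral_exp_neg_integral_intensityMeasure h.shocks hlam hμ hF
      (fun u => (hittingCDF_mem_Icc u).1) (fun _ => hittingCDF_of_neg) ht]

end IsModel

end ShotNoise

theorem mainTheorem2 {Ω : Type*} [MeasurableSpace Ω] (P : Measure Ω) [IsProbabilityMeasure P]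
    (lam μ δ α β L : ℝ) (hlam : 0 < lam) (hμ : 0 < μ) (hδ : 0 < δ) (hα : 0 < α) (hβ : 0 < β)
    (hL : 0 < L) (T S : ℕ → Ω → ℝ) (X : ℕ → ℝ≥0 → Ω → ℝ)
    (hM : ShotNoise.IsModel P lam μ δ α β T S X) :
    -- the distribution function of the hitting times
    (∀ k, ShotNoise.hittingCDF P L (X k) 0 = 0 ∧
      ∀ t, 0 < t → ShotNoise.hittingCDF P L (X k) t =
        (∫ z in Ioi (β * L), z ^ (α * t - 1) * Real.exp (-z)) / Real.Gamma (α * t)) ∧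
    -- the failure time is IFR
    ShotNoise.IsIFR P (ShotNoise.failureTime L S X) ∧
    -- the failure rate on the whole half-line
    (∀ t, 0 ≤ t → 0 < ShotNoise.survival P (ShotNoise.failureTime L S X) t) ∧
    (∀ k t, 0 ≤ t → ShotNoise.failureRate P (ShotNoise.failureTime L S X) t =
      lam * ShotNoise.hittingCDF P L (X k) t +
        μ * (1 - Real.exp (-∫ w in (0 : ℝ)..t,
          Real.exp (-δ * w) * ShotNoise.hittingCDF P L (X k) (t - w)))) ∧
    MonotoneOn (ShotNoise.failureRate P (ShotNoise.failureTime L S X)) (Ici 0) ∧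
    Tendsto (ShotNoise.failureRate P (ShotNoise.failureTime L S X)) atTop
      (𝓝 (lam + μ * (1 - Real.exp (-1 / δ)))) := by
  set F := ShotNoise.hittingCDF P L (X 0)
  have hF : Continuous F := (hM.growth 0).continuous_hittingCDF hα hβ hL
  have hF01 : ∀ t, F t ∈ Icc (0 : ℝ) 1 := ShotNoise.hittingCDF_mem_Icc
  have hrate := hM.hasHazardRate_failureTime hlam.le hμ.le hα hβ hL
  have hcont : Continuous (ShotNoise.hazard lam μ δ F) := ShotNoise.continuous_hazard hF
  have hmono : MonotoneOn (ShotNoise.hazard lam μ δ F) (Ici 0) :=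
    ShotNoise.monotoneOn_hazard hlam.le hμ.le hF (fun t => (hF01 t).1) ShotNoise.monotone_hittingCDF
  have hlim := ShotNoise.tendsto_hazard (lam := lam) (μ := μ) hδ hF.measurable hF01
    (fun _ => ShotNoise.hittingCDF_of_neg) ((hM.growth 0).tendsto_hittingCDF hα hβ hL)
  refine ⟨fun k => ⟨?_, fun t ht => (hM.growth k).hittingCDF_of_nonneg hα hβ hL ht.le⟩,
    (hrate 0).isIFR hM.aemeasurable_failureTime hM.ae_failureTime_nonneg hcont hmono
      (ShotNoise.hazard_limit_pos hlam hμ.le hδ) hlim,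
    fun t ht => (hrate 0).survival_pos ht,
    fun k t ht => (hrate k).failureRate_eq
      (ShotNoise.continuous_hazard ((hM.growth k).continuous_hittingCDF hα hβ hL)) ht,
    (hrate 0).monotoneOn_failureRate hcont hmono, (hrate 0).tendsto_failureRate hcont hlim⟩
  rw [(hM.growth k).hittingCDF_of_nonneg hα hβ hL le_rfl, mul_zero, ShotNoise.gammaTail_zero]
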